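/- Let $\mathcal H$ be a separable complex Hilbert space, $\mathcal L(\mathcal H)$ the bounded operators on it. All inner products are linear in the first argument. For a set $X$, a kernel $K:X\times X\to\mathcal L(\mathcal H)$ is *positive definite* if for all finitely many distinct points $x_1,\dots,x_n\in X$ and all $v_1,\dots,v_n\in\mathcal H$ $$\sum_{i,j=1}^n\langle K(x_i,x_j)v_j,v_i\rangle\ge 0,$$ and *strictly positive definite* if in addition the sum vanishes only when all $v_i=0$; a scalar kernel $k:X\times X\to\mathbb C$ is positive definite if $\sum_{i,j}\overline{c_i}c_jk(x_i,x_j)\ge0$ for all distinct $x_i\in X$ and $c_i\in\mathbb C$. The RKHS $\mathcal H_K$ of a positive definite $K$ is the Hilbert space of functions $X\to\mathcal H$ obtained by completing $\operatorname{span}\{K(\cdot,x)v: x\in X, v\in\mathcal H\}$ under $\langle K(\cdot,x)v,K(\cdot,y)u\rangle_{\mathcal H_K}=\langle v,K(x,y)u\rangle$. For a locally compact Hausdorff space $X$, $C_0(X,\mathcal H)$ is the set of continuous $f:X\to\mathcal H$ such that for every $\varepsilon>0$ one has $\|f\|<\varepsilon$ outside some compact set. A positive definite $K$ is *universal* if $\mathcal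 H_K\subset C(X,\mathcal H)$ and for every compact $A\subset X$, every continuous $g:A\to\mathcal H$ and every $\varepsilon>0$ there is $f\in\mathcal H_K$ with $\sup_{A}\|f-g\|<\varepsilon$; it is *$C_0$-universal* if $\mathcal H_K\subset C_0(X,\mathcal H)$ and for every $g\in C_0(X,\mathcal H)$ and $\varepsilon>0$ there is $f\in\mathcal H_K$ with $\sup_X\|f-g\|<\varepsilon$. **Theorem.** Let $F:[0,\infty)\to\mathcal L(\mathcal H)$ be ultraweakly continuous (that is, $t\mapsto\sum_n\langle F(t)u_n,v_n\rangle$ is continuous whenever $\sum_n\|u_n\|^2<\infty$ and $\sum_n\|v_n\|^2<\infty$), let $F(0)$ be a trace class operator, and suppose that for every integer $m\ge1$ and every $v\in\mathcal H$ the scalar kernel $(x,y)\mapsto\langle F(\|x-y\|)v,v\rangle$ on $\mathbb R^m$ is positive definite. Then for every integer $m\ge1$ the kernel $K_F(x,y)=F(\|x-y\|)$ on $\mathbb R^m$ is positive definite, $\mathcal H_{K_F}\subset C(\mathbb R^m,\mathcal H)$, and the following are equivalent: 1. $K_F$ is strictly positive definite on $\mathbb R^m$; 2. $K_F$ is universal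 on $\mathbb R^m$; 3. for every $v\in\mathcal H\setminus\{0\}$ the function $t\mapsto\langle F(t)v,v\rangle$ on $[0,\infty)$ is nonconstant. Moreover, $\mathcal H_{K_F}\subset C_0(\mathbb R^m,\mathcal H)$ if and only if for every $v\in\mathcal H\setminus\{0\}$ the function $t\mapsto\langle F(t)v,v\rangle$ belongs to $C_0([0,\infty))$; and if $\mathcal H_{K_F}\subset C_0(\mathbb R^m,\mathcal H)$, the following are equivalent: 1. $K_F$ is strictly positive definite on $\mathbb R^m$; 2. $K_F$ is $C_0$-universal on $\mathbb R^m$; 3. for every $v\in\mathcal H\setminus\{0\}$ the function $t\mapsto\langle F(t)v,v\rangle$ is not identically zero. -/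

import Mathlib

open scoped NNReal ComplexOrder

section GeneralKernels

variable {X : Type*} {H : Type*} [NormedAddCommGroup H] [InnerProductSpace ℂ H]

/-- An operator valued kernel `K : X × X → L(H)` is positive definite if
`∑ᵢⱼ ⟨K(xᵢ, xⱼ) vⱼ, vᵢ⟩` is a nonnegative real number for all finitely many distinct points `xᵢ`
and all vectors `vᵢ`. (The inner product of Mathlib is linear in its second argument.) -/
def IsPDKernel (K : X → X → H →L[ℂ] H) : Prop :=
  ∀ (n : ℕ) (x : Fin n → X) (v : Fin n → H), Function.Injective x →
    0 ≤ ∑ i, ∑ j, inner ℂ (v i) (K (x i) (x j) (v j))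

/-- A positive definite operator valued kernel is strictly positive definite if the quadratic form
vanishes only when all the vectors vanish. -/
def IsStrictlyPDKernel (K : X → X → H →L[ℂ] H) : Prop :=
  IsPDKernel K ∧
    ∀ (n : ℕ) (x : Fin n → X) (v : Fin n → H), Function.Injective x →
      ∑ i, ∑ j, inner ℂ (v i) (K (x i) (x j) (v j)) = 0 → ∀ i, v i = 0

/-- Positive definiteness of a complex valued kernel. -/
def IsPDScalarKernel (k : X → X → ℂ) : Prop :=
  ∀ (n : ℕ) (x : Fin n → X) (c : Fin n → ℂ), Function.Injective x →
    0 ≤ ∑ i, ∑ j, star (c i) * c j * k (x i) (x j)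

variable [CompleteSpace H]

theorem IsPDKernel.isHermitian {K : X → X → H →L[ℂ] H} (hK : IsPDKernel K) :
    (Matrix.of K).IsHermitian := by
  have key : ∀ x y v w, inner ℂ v (K x y w) = star (inner ℂ w (K y x v)) := by
    have diag : ∀ x v, (inner ℂ v (K x x v)).im = 0 := by
      intro x v
      have h := hK 1 (fun _ => x) (fun _ => v) (Function.injective_of_subsingleton _)
      simpa using (Complex.nonneg_iff.1 h).2.symm
    have e : ∀ x y v w, (inner ℂ v (K x y w) + inner ℂ w (K y x v)).im = 0 := by
      intro x y v w
      rcases eq_or_ne x y with rfl | hxy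
      · have h := diag x (v + w)
        have h1 := diag x v
        have h2 := diag x w
        simp only [map_add, inner_add_left, inner_add_right, Complex.add_im] at h ⊢
        linarith
      · have h := hK 2 ![x, y] ![v, w] (by
          intro a b; fin_cases a <;> fin_cases b <;> simp [hxy, hxy.symm])
        have h := (Complex.nonneg_iff.1 h).2
        have h1 := diag x v
        have h2 := diag y w
        simp [Fin.sum_univ_two] at h ⊢
        linarith
    intro x y v w
    have h1 := e x y v w
    have h2 := e x y v (Complex.I • w)
    simp only [map_smul, inner_smul_left, inner_smul_right, Complex.add_im, Complex.mul_im,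
      Complex.conj_I, Complex.neg_re, Complex.neg_im, Complex.I_re, Complex.I_im] at h1 h2
    apply Complex.ext
    · rw [Complex.star_def, Complex.conj_re]; linarith
    · rw [Complex.star_def, Complex.conj_im]; linarith
  ext x y v
  refine ext_inner_left ℂ fun w => ?_
  simp only [Matrix.conjTranspose_apply, Matrix.of_apply, ContinuousLinearMap.star_eq_adjoint,
    ContinuousLinearMap.adjoint_inner_right]
  rw [key x y w v, ← inner_conj_symm]
  rfl

/-- The kernel is a positive semidefinite matrix in the sense of Mathlib, so that Mathlib's
construction of its reproducing kernel Hilbert space applies. -/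
theorem IsPDKernel.posSemidef {K : X → X → H →L[ℂ] H} (hK : IsPDKernel K) :
    (Matrix.of K).PosSemidef := by
  refine ((RKHS.posSemidef_tfae (K := Matrix.of K)).out 0 2 rfl rfl).mpr ⟨hK.isHermitian, fun f => ?_⟩
  have h := hK f.support.card (fun i => (f.support.equivFin.symm i : X))
    (fun i => f (f.support.equivFin.symm i))
    (Subtype.val_injective.comp f.support.equivFin.symm.injective)
  have h' := (Complex.nonneg_iff.1 h).1
  rw [Equiv.sum_comp f.support.equivFin.symm (fun a : f.support => ∑ j,
    inner ℂ (f a) (K a (f.support.equivFin.symm j) (f (f.support.equivFin.symm j))))] at h'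
  have e : ∀ a : f.support, ∑ j,
      inner ℂ (f a) (K a (f.support.equivFin.symm j) (f (f.support.equivFin.symm j)))
      = ∑ b : f.support, inner ℂ (f a) (K a b (f b)) := fun a =>
    Equiv.sum_comp f.support.equivFin.symm (fun b : f.support => inner ℂ (f a) (K a b (f b)))
  simp only [e] at h'
  have e2 : ∀ a : X, ∑ b : f.support, inner ℂ (f a) (K a b (f b)) =
      ∑ b ∈ f.support, inner ℂ (f a) (K a b (f b)) := fun a =>
    Finset.sum_coe_sort f.support (fun b => inner ℂ (f a) (K a b (f b)))
  simp only [e2] at h'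
  rw [Finset.sum_coe_sort f.support (fun a => ∑ b ∈ f.support, inner ℂ (f a) (K a b (f b)))] at h'
  have this : ∀ x w x' w', (inner ℂ (K x' x w) w').re = (inner ℂ w' (K x' x w)).re :=
    fun x w x' w' => inner_re_symm (𝕜 := ℂ) _ _
  have goal : (0 : ℝ) ≤
      (∑ a ∈ f.support, ∑ b ∈ f.support, inner ℂ (K b a (f a)) (f b)).re := by
    refine h'.trans_eq ?_
    rw [Finset.sum_comm]
    simp only [Complex.re_sum, this]
  exact goal

/-- The reproducing kernel Hilbert space of a positive definite kernel, as a set of functions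
`X → H`: the functions represented by the completion of the span of the functions
`K_x v = K(·, x) v` under `⟨K_x v, K_y u⟩ = ⟨v, K(x, y) u⟩`. -/
def rkhsFunctions {K : X → X → H →L[ℂ] H} (hK : IsPDKernel K) : Set (X → H) :=
  haveI : Fact (Matrix.of K).PosSemidef := ⟨hK.posSemidef⟩
  Set.range fun f : RKHS.OfKernel (Matrix.of K) => (f : X → H)

/-- Membership in `C₀(X, E)`: continuous, and smaller than every `ε > 0` off a compact set. -/
def IsCZero {Y E : Type*} [TopologicalSpace Y] [NormedAddCommGroup E] (f : Y → E) : Prop :=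
  Continuous f ∧ ∀ ε : ℝ, 0 < ε → ∃ A : Set Y, IsCompact A ∧ ∀ y, y ∉ A → ‖f y‖ < ε

variable [TopologicalSpace X]

/-- A positive definite kernel is universal if its RKHS consists of continuous functions and
approximates every continuous function on every compact set uniformly. -/
def IsUniversalKernel (K : X → X → H →L[ℂ] H) : Prop :=
  ∃ hK : IsPDKernel K, (∀ f ∈ rkhsFunctions hK, Continuous f) ∧
    ∀ A : Set X, IsCompact A → ∀ g : A → H, Continuous g → ∀ ε : ℝ, 0 < ε →
      ∃ f ∈ rkhsFunctions hK, ∀ x : A, ‖f x - g x‖ < ε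

/-- A positive definite kernel is `C₀`-universal if its RKHS is contained in `C₀(X, H)` and
approximates every function in `C₀(X, H)` uniformly on `X`. -/
def IsCZeroUniversalKernel (K : X → X → H →L[ℂ] H) : Prop :=
  ∃ hK : IsPDKernel K, (∀ f ∈ rkhsFunctions hK, IsCZero f) ∧
    ∀ g : X → H, IsCZero g → ∀ ε : ℝ, 0 < ε →
      ∃ f ∈ rkhsFunctions hK, ∀ x, ‖f x - g x‖ < ε

end GeneralKernels

section Operators

variable {H : Type*} [NormedAddCommGroup H] [InnerProductSpace ℂ H]

/-- Continuity with respect to the ultraweak (σ-weak) topology of `L(H)`, the initial topology of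
the functionals `T ↦ ∑ₙ ⟨T uₙ, vₙ⟩` with `∑ ‖uₙ‖² < ∞` and `∑ ‖vₙ‖² < ∞`. -/
def UltraweaklyContinuous {Y : Type*} [TopologicalSpace Y] (F : Y → H →L[ℂ] H) : Prop :=
  ∀ u v : ℕ → H, Summable (fun n => ‖u n‖ ^ 2) → Summable (fun n => ‖v n‖ ^ 2) →
    Continuous fun t => ∑' n, inner ℂ (v n) (F t (u n))

/-- A bounded operator `T` is of trace class if `|T| = (T* T)^{1/2}` has finite trace,
`∑ᵢ ⟨|T| bᵢ, bᵢ⟩ < ∞` in an orthonormal basis. As `|T|` is positive, the value of the sum does not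
depend on the basis. -/
def IsTraceClassOperator [CompleteSpace H] (T : H →L[ℂ] H) : Prop :=
  ∃ (s : Set H) (b : HilbertBasis s ℂ H),
    Summable fun i => (inner ℂ (b i) (CFC.abs T (b i))).re

/-- The radial kernel `(x, y) ↦ F(‖x - y‖)` on `ℝᵐ`. -/
noncomputable def radialKernel (F : ℝ≥0 → H →L[ℂ] H) (m : ℕ) :
    EuclideanSpace ℝ (Fin m) → EuclideanSpace ℝ (Fin m) → H →L[ℂ] H :=
  fun x y => F ‖x - y‖₊

/-- The scalar function `t ↦ ⟨F(t) v, v⟩`. -/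
noncomputable def scalarProjection (F : ℝ≥0 → H →L[ℂ] H) (v : H) : ℝ≥0 → ℂ :=
  fun t => inner ℂ v (F t v)

end Operators

/-!
The hypothesis for all dimensions makes `G r = F (√r)` completely monotone in the operator sense.
Replace every point of a configuration by copies displaced in fresh orthogonal directions: squared
distances between different copies grow by a constant `h`, and weighting the copies suitably shows
that `G (· + h)` and `G - G (· + h)` are again radially positive definite in all dimensions
(`IsPDRadial.shift`, `IsPDRadial.sub_shift`). On an arithmetic progression the values of `G`
therefore solve an operator valued Hausdorff moment problem. Its solution, obtained as a limit of
Bernstein sums (`exists_completelyPositive_extension`), is a completely positive map `Λ` on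
`C([0, 1])`. By continuity `F t = Λ(x ^ (t ^ 2))` for all `t` (`exists_completelyPositive_rpowI`):
with `x = exp(-w)` this writes `F` as an operator valued mixture of the Gaussians `exp(-w t ^ 2)`,
including the constant at `x = 1` and the indicator of `t = 0` at `x = 0`. As Gaussian kernels are
positive definite (`posSemidef_rpowI`), so is `K_F`.

A function `t ↦ ⟨F(t) v, v⟩` is nonnegative and decreasing, and `‖T v‖² ≤ ‖T‖ ⟨T v, v⟩` for positive
`T`. So weak continuity and weak decay of `F` imply norm continuity and norm decay of `F t v`, which
settles the inclusions of the reproducing kernel Hilbert space in `C` and `C₀`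
(`rkhsFunctions_continuous`, `rkhsFunctions_isCZero_iff`).

Either kind of universality implies strictness, because functions of the space then interpolate
approximately on finite sets, and a vanishing quadratic form annihilates all functions of the space
(`isStrictlyPDKernel_of_interpolation`). Strictness makes the projections nonconstant by a look at
two points. It remains to prove universality when all projections are nonconstant. The integral of
`K(·, y) v` against the inverse Fourier transform of a test function `φ` supported away from `0`
belongs to the space, and on the Fourier side it is the integral of
`φ ξ exp(2πi ⟨ξ, x⟩) Λ(γ_ξ) v`, where `γ_ξ` collects the Fourier transforms of the Gaussians
(`integral_fourierInv_smul_rpowI`). The function `γ_ξ` on `[0, 1]` vanishes only at the end points,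
so a vector orthogonal to the range of `Λ(γ_ξ)` has a constant projection; hence the range is dense
(`denseRange_gaussSymbol`). A partition of unity in frequency space now allows the vector
`Λ(γ_ξ) v` to be replaced by an arbitrary fixed `u` (`exists_rkhsFunctions_approx_fourierInv`), so
that `ρ(·) u` is a uniform limit on the whole space for every smooth compactly supported `ρ`, and a
partition of unity in space gives all the functions to be approximated
(`exists_rkhsFunctions_approx_on`).
-/

open scoped NNReal ComplexOrder unitInterval Topology
open Filter Polynomial MeasureTheory

/-! ### Positive operators -/

section PositiveOperators

variable {H : Type*} [NormedAddCommGroup H] [InnerProductSpace ℂ H]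

theorem exists_eq_adjoint_comp_self [CompleteSpace H] {T : H →L[ℂ] H}
    (hT : ∀ v, 0 ≤ inner ℂ v (T v)) :
    ∃ S : H →L[ℂ] H, T = S.adjoint ∘L S := by
  have h : 0 ≤ T := by
    rw [ContinuousLinearMap.nonneg_iff_isPositive, ContinuousLinearMap.isPositive_iff_complex]
    intro v
    have h1 := Complex.nonneg_iff.1 (hT v)
    have h2 : inner ℂ (T v) v = inner ℂ v (T v) := by
      rw [← inner_conj_symm]
      apply Complex.ext <;> simp [-inner_conj_symm, ← h1.2]
    rw [h2]
    exact ⟨Complex.ext rfl h1.2, h1.1⟩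
  obtain ⟨S, hS⟩ := CStarAlgebra.nonneg_iff_eq_star_mul_self.1 h
  exact ⟨S, hS⟩

theorem inner_adjoint_comp_self [CompleteSpace H] (S : H →L[ℂ] H) (v : H) :
    inner ℂ v ((S.adjoint ∘L S) v) = ((‖S v‖ ^ 2 : ℝ) : ℂ) := by
  simp [ContinuousLinearMap.adjoint_inner_right, inner_self_eq_norm_sq_to_K]

/-- For a positive operator, smallness of the quadratic form at `v` forces smallness of `T v`. -/
theorem norm_apply_sq_le_of_nonneg [CompleteSpace H] {T : H →L[ℂ] H}
    (hT : ∀ v, 0 ≤ inner ℂ v (T v)) (v : H) :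
    ‖T v‖ ^ 2 ≤ ‖T‖ * (inner ℂ v (T v)).re := by
  obtain ⟨S, rfl⟩ := exists_eq_adjoint_comp_self hT
  rw [inner_adjoint_comp_self, Complex.ofReal_re, ContinuousLinearMap.norm_adjoint_comp_self,
    ContinuousLinearMap.comp_apply]
  have h := S.adjoint.le_opNorm (S v)
  rw [LinearIsometryEquiv.norm_map] at h
  calc _ ≤ (‖S‖ * ‖S v‖) ^ 2 := by gcongr
    _ = _ := by ring

/-- A combination of positive operators is bounded by the largest coefficient times the norm of
the sum of the operators. -/
theorem norm_sum_smul_le [CompleteSpace H] {ι : Type*} [Fintype ι] {T : ι → H →L[ℂ] H}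
    (hT : ∀ i v, 0 ≤ inner ℂ v (T i v)) {c : ι → ℂ} {B : ℝ} (hB : 0 ≤ B) (hc : ∀ i, ‖c i‖ ≤ B) :
    ‖∑ i, c i • T i‖ ≤ B * ‖∑ i, T i‖ := by
  choose S hS using fun i => exists_eq_adjoint_comp_self (hT i)
  have key : ∀ u : H, ∑ i, ‖S i u‖ ^ 2 ≤ ‖∑ i, T i‖ * ‖u‖ ^ 2 := by
    intro u
    have h : ((∑ i, ‖S i u‖ ^ 2 : ℝ) : ℂ) = inner ℂ u ((∑ i, T i) u) := by
      rw [sum_apply, inner_sum, Complex.ofReal_sum]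
      refine Finset.sum_congr rfl fun i _ => ?_
      rw [hS i, inner_adjoint_comp_self]
    calc ∑ i, ‖S i u‖ ^ 2 = ‖((∑ i, ‖S i u‖ ^ 2 : ℝ) : ℂ)‖ := by
          rw [Complex.norm_real, Real.norm_of_nonneg (by positivity)]
      _ ≤ ‖u‖ * (‖∑ i, T i‖ * ‖u‖) := by
          rw [h]
          refine (norm_inner_le_norm _ _).trans ?_
          gcongr
          exact ContinuousLinearMap.le_opNorm _ _
      _ = _ := by ring
  refine ContinuousLinearMap.opNorm_le_of_re_inner_le (𝕜 := ℂ) (by positivity) fun u v hu hv => ?_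
  refine (Complex.re_le_norm _).trans ?_
  calc ‖inner ℂ ((∑ i, c i • T i) u) v‖ ≤ ∑ i, B * (‖S i u‖ * ‖S i v‖) := by
        rw [sum_apply, sum_inner]
        refine (norm_sum_le _ _).trans (Finset.sum_le_sum fun i _ => ?_)
        rw [smul_apply, inner_smul_left, hS i, ContinuousLinearMap.comp_apply,
          ContinuousLinearMap.adjoint_inner_left, norm_mul, RCLike.norm_conj]
        gcongr
        · exact hc i
        · exact norm_inner_le_norm _ _
    _ ≤ B * (√(∑ i, ‖S i u‖ ^ 2) * √(∑ i, ‖S i v‖ ^ 2)) := by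
        rw [← Finset.mul_sum]
        gcongr
        exact Real.sum_mul_le_sqrt_mul_sqrt _ _ _
    _ ≤ B * (√(‖∑ i, T i‖ * ‖u‖ ^ 2) * √(‖∑ i, T i‖ * ‖v‖ ^ 2)) := by
        gcongr <;> exact key _
    _ = _ := by
        rw [Real.sqrt_mul (norm_nonneg _), Real.sqrt_mul (norm_nonneg _),
          Real.sqrt_sq (norm_nonneg _), Real.sqrt_sq (norm_nonneg _)]
        rw [hu, hv]
        linear_combination B * Real.mul_self_sqrt (norm_nonneg (∑ i, T i))

theorem sum_inner_nonneg_of_posSemidef {ι : Type*} [Fintype ι] {T : H →L[ℂ] H}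
    (hT : ∀ v, 0 ≤ inner ℂ v (T v)) {G : Matrix ι ι ℂ} (hG : G.PosSemidef) (v : ι → H) :
    0 ≤ ∑ i, ∑ j, G i j * inner ℂ (v i) (T (v j)) := by
  classical
  obtain ⟨B, rfl⟩ : ∃ B : Matrix ι ι ℂ, G = B.conjTranspose * B := by
    open scoped MatrixOrder in exact CStarAlgebra.nonneg_iff_eq_star_mul_self.1 hG.nonneg
  have h : ∑ i, ∑ j, (B.conjTranspose * B) i j * inner ℂ (v i) (T (v j))
      = ∑ l, inner ℂ (∑ i, B l i • v i) (T (∑ j, B l j • v j)) := by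
    simp only [Matrix.mul_apply, Matrix.conjTranspose_apply, map_sum, inner_sum, sum_inner,
      map_smul, inner_smul_left, inner_smul_right, Finset.sum_mul, Finset.mul_sum]
    rw [Finset.sum_congr rfl fun i _ => Finset.sum_comm, Finset.sum_comm]
    refine Finset.sum_congr rfl fun l _ => ?_
    rw [Finset.sum_comm]
    refine Finset.sum_congr rfl fun i _ => Finset.sum_congr rfl fun j _ => ?_
    simp only [RCLike.star_def]; ring
  rw [h]
  exact Finset.sum_nonneg fun l _ => hT _

end PositiveOperators

/-! ### The Hausdorff moment problem for operators -/

theorem choose_ratio_sub_pow_le (j : ℕ) : ∀ n k : ℕ, j ≤ n → k ≤ n → 0 < n →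
    |(k.choose j : ℝ) / n.choose j - ((k : ℝ) / n) ^ j| ≤ j * j / n := by
  induction j with
  | zero => intro n k _ _ hn; simp
  | succ j ih =>
    intro n k hj hk hn
    have hn' : (0 : ℝ) < n := by exact_mod_cast hn
    have e : ∀ m : ℕ, (m.choose (j + 1) : ℝ) = m.choose j * ((m - j : ℕ) : ℝ) / (j + 1) := by
      intro m
      rw [eq_div_iff (by positivity)]
      exact_mod_cast Nat.choose_succ_right_eq m j
    have hnj : (0 : ℝ) < ((n - j : ℕ) : ℝ) := by exact_mod_cast (by omega : 0 < n - j)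
    have hc : (0 : ℝ) < n.choose j := by exact_mod_cast Nat.choose_pos (by omega)
    have e1 : (k.choose (j + 1) : ℝ) / n.choose (j + 1) =
        (k.choose j : ℝ) / n.choose j * (((k - j : ℕ) : ℝ) / ((n - j : ℕ) : ℝ)) := by
      rw [e, e]; field_simp
    have hB : |((k - j : ℕ) : ℝ) / ((n - j : ℕ) : ℝ)| ≤ 1 := by
      rw [abs_of_nonneg (by positivity), div_le_one hnj]
      exact_mod_cast (by omega : k - j ≤ n - j)
    have ha : |((k : ℝ) / n) ^ j| ≤ 1 := by
      rw [abs_of_nonneg (by positivity)]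
      exact pow_le_one₀ (by positivity) ((div_le_one hn').2 (by exact_mod_cast hk))
    have hBb : |((k - j : ℕ) : ℝ) / ((n - j : ℕ) : ℝ) - (k : ℝ) / n| ≤ j / n := by
      rcases le_or_gt j k with h | h
      · have hk' : (k : ℝ) ≤ n := by exact_mod_cast hk
        have hj' : (j : ℝ) ≤ k := by exact_mod_cast h
        rw [Nat.cast_sub (by omega)] at hnj
        rw [Nat.cast_sub h, Nat.cast_sub (by omega)]
        have : ((k : ℝ) - j) / (n - j) - k / n = -(j / n * ((n - k) / (n - j))) := by
          field_simp; ring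
        rw [this, abs_neg, abs_of_nonneg]
        · exact mul_le_of_le_one_right (by positivity) ((div_le_one hnj).2 (by linarith))
        · exact mul_nonneg (by positivity) (div_nonneg (by linarith) hnj.le)
      · rw [Nat.sub_eq_zero_of_le h.le]
        simp only [Nat.cast_zero, zero_div, zero_sub, abs_neg]
        rw [abs_of_nonneg (by positivity)]
        gcongr
    have ih' := ih n k (by omega) hk hn
    rw [e1, pow_succ]
    set A := (k.choose j : ℝ) / n.choose j
    set B := ((k - j : ℕ) : ℝ) / ((n - j : ℕ) : ℝ)
    set a := ((k : ℝ) / n) ^ j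
    set b := (k : ℝ) / n
    have : A * B - a * b = (A - a) * B + a * (B - b) := by ring
    rw [this]
    calc _ ≤ |A - a| * |B| + |a| * |B - b| := by
          rw [← abs_mul, ← abs_mul]; exact abs_add_le _ _
      _ ≤ (j * j / n) * 1 + 1 * (j / n) := by gcongr
      _ ≤ _ := by
          rw [mul_one, one_mul, ← add_div]
          gcongr
          push_cast
          nlinarith [(Nat.cast_nonneg j : (0 : ℝ) ≤ j)]

/-- The exact expansion of `X ^ j` in Bernstein polynomials. Its coefficients differ by `O(1 / n)`
from the values `(k / n) ^ j` used by the Bernstein approximation. -/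
theorem sum_choose_ratio_smul_bernsteinPolynomial {j n : ℕ} (hj : j ≤ n) :
    ∑ k : Fin (n + 1), (((k : ℕ).choose j : ℂ) / n.choose j) • bernsteinPolynomial ℂ n k
      = X ^ j := by
  obtain ⟨d, rfl⟩ := Nat.exists_eq_add_of_le hj
  have hc : (((j + d).choose j : ℕ) : ℂ) ≠ 0 := by
    exact_mod_cast (Nat.choose_pos (by omega)).ne'
  rw [Fin.sum_univ_eq_sum_range
    (fun k => ((k.choose j : ℂ) / (j + d).choose j) • bernsteinPolynomial ℂ (j + d) k),
    add_assoc, Finset.sum_range_add, Finset.sum_eq_zero, zero_add]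
  · have h : (X : ℂ[X]) ^ j = X ^ j * (X + (1 - X)) ^ d := by simp
    rw [h, add_pow, Finset.mul_sum]
    refine Finset.sum_congr rfl fun i hi => ?_
    have hi' : i ≤ d := by simpa [Nat.lt_succ_iff] using hi
    have h1 : (j + d).choose (j + i) * (j + i).choose j = (j + d).choose j * d.choose i := by
      have := Nat.choose_mul (n := j + d) (k := j + i) (s := j) (by omega)
      simpa using this
    have h2 : (((j + i).choose j : ℂ) / (j + d).choose j) * ((j + d).choose (j + i) : ℂ)
        = (d.choose i : ℂ) := by
      rw [div_mul_eq_mul_div, div_eq_iff hc]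
      have : ((j + d).choose (j + i) : ℂ) * (j + i).choose j = (j + d).choose j * d.choose i := by
        exact_mod_cast h1
      linear_combination this
    rw [bernsteinPolynomial, show j + d - (j + i) = d - i by omega, pow_add, smul_eq_C_mul]
    have h3 := congrArg (C : ℂ → ℂ[X]) h2
    simp only [map_mul, map_natCast] at h3
    linear_combination X ^ j * X ^ i * (1 - X) ^ (d - i) * h3
  · intro k hk
    rw [Nat.choose_eq_zero_of_lt (by simpa using hk)]; simp

/-- The linear functional on polynomials with prescribed moments `a`. -/
noncomputable def momentFunctional {E : Type*} [AddCommGroup E] [Module ℂ E] (a : ℕ → E) :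
    ℂ[X] →ₗ[ℂ] E :=
  (Polynomial.basisMonomials ℂ).constr ℂ a

@[simp]
theorem momentFunctional_X_pow {E : Type*} [AddCommGroup E] [Module ℂ E] (a : ℕ → E) (k : ℕ) :
    momentFunctional a (X ^ k) = a k := by
  have h := (Polynomial.basisMonomials ℂ).constr_basis ℂ a k
  rw [X_pow_eq_monomial, momentFunctional]
  simpa using h

theorem momentFunctional_X_mul {E : Type*} [AddCommGroup E] [Module ℂ E] (a : ℕ → E) (p : ℂ[X]) :
    momentFunctional a (X * p) = momentFunctional (fun k => a (k + 1)) p := by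
  induction p using Polynomial.induction_on with
  | C c => rw [mul_comm, ← smul_eq_C_mul, ← mul_one (C c), ← smul_eq_C_mul, map_smul, map_smul,
      ← pow_zero X, momentFunctional_X_pow, ← pow_one (X : ℂ[X]), momentFunctional_X_pow]
  | add p q hp hq => rw [mul_add, map_add, map_add, hp, hq]
  | monomial n c _ =>
    rw [← smul_eq_C_mul, mul_smul_comm, ← pow_succ', map_smul, map_smul, momentFunctional_X_pow,
      momentFunctional_X_pow]

section HausdorffMoment

variable {H : Type*} [NormedAddCommGroup H] [InnerProductSpace ℂ H]

/-- Evaluation of complex polynomials on the unit interval. -/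
noncomputable def polyI : ℂ[X] →ₗ[ℂ] C(I, ℂ) where
  toFun p := ⟨fun x => p.eval ((x : ℝ) : ℂ), by fun_prop⟩
  map_add' p q := by ext; simp
  map_smul' c p := by ext; simp

/-- The Bernstein sums `∑ₖ g(k/n) L(bₙₖ)` of a functional `L` on polynomials. -/
noncomputable def bernsteinFunctional (L : ℂ[X] →ₗ[ℂ] H →L[ℂ] H) (n : ℕ) :
    C(I, ℂ) →ₗ[ℂ] H →L[ℂ] H where
  toFun g := ∑ k : Fin (n + 1), g (bernstein.z k) • L (bernsteinPolynomial ℂ n k)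
  map_add' f g := by simp [add_smul, Finset.sum_add_distrib]
  map_smul' c g := by simp [mul_smul, Finset.smul_sum]

theorem sum_bernsteinPolynomial_apply (L : ℂ[X] →ₗ[ℂ] H →L[ℂ] H) (n : ℕ) :
    ∑ k : Fin (n + 1), L (bernsteinPolynomial ℂ n k) = L 1 := by
  rw [← map_sum, Fin.sum_univ_eq_sum_range (fun k => bernsteinPolynomial ℂ n k),
    bernsteinPolynomial.sum]

theorem bernsteinPolynomial_apply_nonneg {L : ℂ[X] →ₗ[ℂ] H →L[ℂ] H}
    (hL : ∀ k l v, 0 ≤ inner ℂ v (L (X ^ k * (1 - X) ^ l) v)) (n k : ℕ) (v : H) :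
    0 ≤ inner ℂ v (L (bernsteinPolynomial ℂ n k) v) := by
  have h : bernsteinPolynomial ℂ n k = (n.choose k : ℂ) • (X ^ k * (1 - X) ^ (n - k)) := by
    rw [bernsteinPolynomial, smul_eq_C_mul, map_natCast, mul_assoc]
  rw [h, map_smul, smul_apply, inner_smul_right]
  exact mul_nonneg (by exact_mod_cast Nat.zero_le _) (hL _ _ _)

theorem norm_bernsteinFunctional_le [CompleteSpace H] {L : ℂ[X] →ₗ[ℂ] H →L[ℂ] H}
    (hL : ∀ k l v, 0 ≤ inner ℂ v (L (X ^ k * (1 - X) ^ l) v)) (n : ℕ) (g : C(I, ℂ)) :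
    ‖bernsteinFunctional L n g‖ ≤ ‖L 1‖ * ‖g‖ := by
  have h := norm_sum_smul_le (T := fun k : Fin (n + 1) => L (bernsteinPolynomial ℂ n k))
    (fun k v => bernsteinPolynomial_apply_nonneg hL n k v) (c := fun k => g (bernstein.z k))
    (norm_nonneg g) (fun k => g.norm_coe_le_norm _)
  rw [sum_bernsteinPolynomial_apply, mul_comm] at h
  exact h

/-- The Bernstein sums of a polynomial converge without a boundedness assumption on `L`, since
`X ^ j` is the combination of the Bernstein polynomials with coefficients close to `(k / n) ^ j`. -/
theorem tendsto_bernsteinFunctional_polyI [CompleteSpace H] {L : ℂ[X] →ₗ[ℂ] H →L[ℂ] H}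
    (hL : ∀ k l v, 0 ≤ inner ℂ v (L (X ^ k * (1 - X) ^ l) v)) (p : ℂ[X]) :
    Tendsto (fun n => bernsteinFunctional L n (polyI p)) atTop (𝓝 (L p)) := by
  have key : ∀ j : ℕ, Tendsto (fun n => bernsteinFunctional L n (polyI (X ^ j))) atTop
      (𝓝 (L (X ^ j))) := by
    intro j
    rw [tendsto_iff_norm_sub_tendsto_zero]
    have hlim : Tendsto (fun n : ℕ => ((j : ℝ) * j / n) * ‖L 1‖) atTop (𝓝 0) := by
      simpa using (tendsto_const_div_atTop_nhds_zero_nat ((j : ℝ) * j)).mul_const ‖L 1‖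
    refine squeeze_zero' (Eventually.of_forall fun _ => norm_nonneg _) ?_ hlim
    filter_upwards [eventually_ge_atTop (j + 1)] with n hn
    have e : bernsteinFunctional L n (polyI (X ^ j)) - L (X ^ j) = ∑ k : Fin (n + 1),
        ((((((k : ℕ) : ℝ) / n) ^ j - ((k : ℕ).choose j : ℝ) / n.choose j : ℝ)) : ℂ) •
          L (bernsteinPolynomial ℂ n k) := by
      have hX : L (X ^ j) = ∑ k : Fin (n + 1),
          (((k : ℕ).choose j : ℂ) / n.choose j) • L (bernsteinPolynomial ℂ n k) := by
        rw [← sum_choose_ratio_smul_bernsteinPolynomial (show j ≤ n by omega), map_sum]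
        simp only [map_smul]
      rw [hX]
      simp only [bernsteinFunctional, LinearMap.coe_mk, AddHom.coe_mk, ← Finset.sum_sub_distrib,
        ← sub_smul]
      refine Finset.sum_congr rfl fun k _ => ?_
      have h : polyI (X ^ j) (bernstein.z k) = ((k : ℕ) / n : ℂ) ^ j := by
        simp [polyI, bernstein.z]
      rw [h]
      congr 1
      push_cast
      ring
    rw [e]
    refine (norm_sum_smul_le (T := fun k : Fin (n + 1) => L (bernsteinPolynomial ℂ n k))
      (fun k v => bernsteinPolynomial_apply_nonneg hL n k v)
      (B := (j : ℝ) * j / n) (by positivity) fun k => ?_).trans_eq ?_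
    · rw [Complex.norm_real, Real.norm_eq_abs, abs_sub_comm]
      exact choose_ratio_sub_pow_le j n k (by omega) (by have := k.2; omega) (by omega)
    · rw [sum_bernsteinPolynomial_apply]
  induction p using Polynomial.induction_on' with
  | add p q hp hq => simpa only [map_add] using hp.add hq
  | monomial n c =>
    rw [← mul_one c, ← smul_eq_mul, ← smul_monomial, ← X_pow_eq_monomial]
    simpa only [map_smul] using (key n).const_smul c

theorem denseRange_polyI : DenseRange polyI := by
  intro g
  refine mem_closure_of_tendsto (bernsteinApproximation_uniform g)
    (Eventually.of_forall fun n => ?_)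
  refine ⟨∑ k : Fin (n + 1), g (bernstein.z k) • bernsteinPolynomial ℂ n k, ?_⟩
  ext x
  rw [bernsteinApproximation.apply, map_sum, ContinuousMap.sum_apply]
  refine Finset.sum_congr rfl fun k _ => ?_
  simp [polyI, bernstein_apply, bernsteinPolynomial]
  ring

/-- Complete positivity of a map on the continuous functions on the unit interval, in terms of its
quadratic forms. -/
def IsCompletelyPositive (Λ : C(I, ℂ) →L[ℂ] H →L[ℂ] H) : Prop :=
  ∀ {ι : Type} [Fintype ι] (g : ι → ι → C(I, ℂ)) (v : ι → H),
    (∀ x, (Matrix.of fun i j => g i j x).PosSemidef) →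
    0 ≤ ∑ i, ∑ j, inner ℂ (v i) (Λ (g i j) (v j))

/-- A functional on polynomials that is positive on the products `x ^ k (1 - x) ^ l` extends to a
completely positive map on the continuous functions on the unit interval. -/
theorem exists_completelyPositive_extension [CompleteSpace H] {L : ℂ[X] →ₗ[ℂ] H →L[ℂ] H}
    (hL : ∀ k l v, 0 ≤ inner ℂ v (L (X ^ k * (1 - X) ^ l) v)) :
    ∃ Λ : C(I, ℂ) →L[ℂ] H →L[ℂ] H, (∀ p, Λ (polyI p) = L p) ∧ IsCompletelyPositive Λ := by
  -- The Bernstein sums are equicontinuous in `g` and converge on the dense set of polynomials.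
  have hlim : ∀ g : C(I, ℂ), ∃ T, Tendsto (fun n => bernsteinFunctional L n g) atTop (𝓝 T) := by
    intro g
    refine cauchySeq_tendsto_of_complete (Metric.cauchySeq_iff'.2 fun ε hε => ?_)
    obtain ⟨p, hp⟩ := denseRange_polyI.exists_dist_lt g
      (show 0 < ε / (3 * (‖L 1‖ + 1)) by positivity)
    have hb : ∀ n, ‖bernsteinFunctional L n g - bernsteinFunctional L n (polyI p)‖ ≤ ε / 3 := by
      intro n
      rw [← map_sub]
      refine (norm_bernsteinFunctional_le hL n _).trans ?_
      rw [dist_eq_norm] at hp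
      calc _ ≤ (‖L 1‖ + 1) * (ε / (3 * (‖L 1‖ + 1))) := by gcongr; linarith
        _ = ε / 3 := by field_simp
    obtain ⟨N, hN⟩ := Metric.cauchySeq_iff'.1
      (tendsto_bernsteinFunctional_polyI hL p).cauchySeq (ε / 3) (by positivity)
    refine ⟨N, fun n hn => ?_⟩
    have h1 := hb n
    have h2 := hb N
    have h3 := hN n hn
    rw [dist_eq_norm] at h3 ⊢
    rw [norm_sub_rev] at h2
    have e : bernsteinFunctional L n g - bernsteinFunctional L N g =
      (bernsteinFunctional L n g - bernsteinFunctional L n (polyI p)) +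
      (bernsteinFunctional L n (polyI p) - bernsteinFunctional L N (polyI p)) +
      (bernsteinFunctional L N (polyI p) - bernsteinFunctional L N g) := by abel
    rw [e]
    refine (norm_add₃_le).trans_lt ?_
    linarith
  choose T hT using hlim
  let Λ₀ : C(I, ℂ) →ₗ[ℂ] H →L[ℂ] H :=
    { toFun := T
      map_add' := fun f g => tendsto_nhds_unique (hT (f + g))
        (by simpa only [map_add] using (hT f).add (hT g))
      map_smul' := fun c g => tendsto_nhds_unique (hT (c • g))
        (by simpa only [map_smul, RingHom.id_apply] using (hT g).const_smul c) }
  let Λ : C(I, ℂ) →L[ℂ] H →L[ℂ] H := Λ₀.mkContinuous ‖L 1‖ fun g =>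
    le_of_tendsto (hT g).norm (Eventually.of_forall fun n => norm_bernsteinFunctional_le hL n g)
  have hΛ : ∀ g, Tendsto (fun n => bernsteinFunctional L n g) atTop (𝓝 (Λ g)) := hT
  refine ⟨Λ, fun p => tendsto_nhds_unique (hΛ _) (tendsto_bernsteinFunctional_polyI hL p), ?_⟩
  intro ι _ g v hg
  have h : Tendsto (fun n => ∑ i, ∑ j, inner ℂ (v i) (bernsteinFunctional L n (g i j) (v j)))
      atTop (𝓝 (∑ i, ∑ j, inner ℂ (v i) (Λ (g i j) (v j)))) := by
    refine tendsto_finsetSum _ fun i _ => tendsto_finsetSum _ fun j _ => ?_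
    exact ((innerSL ℂ (v i)).continuous.tendsto _).comp
      (((ContinuousLinearMap.apply ℂ H (v j)).continuous.tendsto _).comp (hΛ (g i j)))
  refine ge_of_tendsto' h fun n => ?_
  have e : ∑ i, ∑ j, inner ℂ (v i) (bernsteinFunctional L n (g i j) (v j)) =
      ∑ k : Fin (n + 1), ∑ i, ∑ j, (Matrix.of fun i j => g i j (bernstein.z k)) i j *
        inner ℂ (v i) (L (bernsteinPolynomial ℂ n k) (v j)) := by
    simp only [bernsteinFunctional, LinearMap.coe_mk, AddHom.coe_mk, sum_apply, smul_apply,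
      inner_sum, inner_smul_right, Matrix.of_apply]
    rw [Finset.sum_congr rfl fun i _ => Finset.sum_comm, Finset.sum_comm]
  rw [e]
  exact Finset.sum_nonneg fun k _ => sum_inner_nonneg_of_posSemidef
    (fun v => bernsteinPolynomial_apply_nonneg hL n k v) (hg _) v

end HausdorffMoment

/-! ### Radial positive definite functions in all dimensions -/

/-- Positivity for families of points with repetitions; equal points are merged by adding up their
coefficients. -/
theorem IsPDScalarKernel.sum_nonneg {X ι : Type*} [Fintype ι] {k : X → X → ℂ}
    (hk : IsPDScalarKernel k) (x : ι → X) (c : ι → ℂ) :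
    0 ≤ ∑ i, ∑ j, star (c i) * c j * k (x i) (x j) := by
  classical
  let s := Finset.univ.image x
  let d : X → ℂ := fun p => ∑ i with x i = p, c i
  have h := hk s.card (fun a => (s.equivFin.symm a : X)) (fun a => d (s.equivFin.symm a))
    (Subtype.val_injective.comp s.equivFin.symm.injective)
  have e1 : ∀ f : X → ℂ, ∑ a : Fin s.card, f (s.equivFin.symm a) = ∑ p ∈ s, f p := by
    intro f
    rw [Equiv.sum_comp s.equivFin.symm (fun p : s => f p), Finset.sum_coe_sort]
  have e2 : ∀ f : X → ℂ, ∑ p ∈ s, d p * f p = ∑ i, c i * f (x i) := by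
    intro f
    rw [← Finset.sum_fiberwise_of_maps_to (s := Finset.univ) (t := s) (g := x)
      (fun i _ => Finset.mem_image_of_mem x (Finset.mem_univ i))]
    refine Finset.sum_congr rfl fun p _ => ?_
    rw [Finset.sum_mul]
    refine Finset.sum_congr rfl fun i hi => ?_
    rw [(Finset.mem_filter.1 hi).2]
  have e3 : ∀ f : X → ℂ, ∑ p ∈ s, star (d p) * f p = ∑ i, star (c i) * f (x i) := by
    intro f
    have h := congrArg star (e2 (fun p => star (f p)))
    simpa only [star_sum, star_mul', star_star] using h
  have e4 : ∀ q, ∑ b : Fin s.card, star (d q) * d (s.equivFin.symm b) *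
      k q (s.equivFin.symm b) = star (d q) * ∑ j, c j * k q (x j) := by
    intro q
    rw [e1 (fun p => star (d q) * d p * k q p), ← e2, Finset.mul_sum]
    simp only [mul_assoc]
  simp only [e4] at h
  rw [e1 (fun q => star (d q) * ∑ j, c j * k q (x j)), e3] at h
  simpa only [Finset.mul_sum, mul_assoc] using h

/-- `φ` is radially positive definite if `φ(|x - y|²)` is a positive definite kernel on every
Euclidean space, that is, for points with any finite set `κ` of coordinates. -/
def IsPDRadial (φ : ℝ≥0 → ℂ) : Prop :=
  ∀ (ι κ : Type) [Fintype ι] [Fintype κ] (x : ι → κ → ℝ) (c : ι → ℂ),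
    0 ≤ ∑ i, ∑ j, star (c i) * c j * φ (∑ a, ‖x i a - x j a‖₊ ^ 2)

theorem isPDRadial_of_forall {f : ℝ≥0 → ℂ} (hf : ∀ m : ℕ, 1 ≤ m →
    IsPDScalarKernel fun x y : EuclideanSpace ℝ (Fin m) => f ‖x - y‖₊) :
    IsPDRadial fun r => f (NNReal.sqrt r) := by
  intro ι κ _ _ x c
  -- An idle extra coordinate makes the dimension positive when `κ` is empty.
  have h := (hf (Fintype.card κ + 1) (by omega)).sum_nonneg
    (fun i => WithLp.toLp 2 (Fin.cons 0 (x i ∘ (Fintype.equivFin κ).symm))) c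
  convert h using 7 with i _ j _
  rw [EuclideanSpace.nnnorm_eq, Fin.sum_univ_succ]
  simp only [PiLp.sub_apply, Fin.cons_zero, sub_self, nnnorm_zero, Fin.cons_succ,
    Function.comp_apply]
  rw [Equiv.sum_comp (Fintype.equivFin κ).symm (fun a => ‖x i a - x j a‖₊ ^ 2)]
  simp

/-- Attaching to every point `N` copies in fresh orthogonal directions moves the mutual squared
distances of different copies up by `h`. -/
theorem IsPDRadial.sum_copies_nonneg {φ : ℝ≥0 → ℂ} (hφ : IsPDRadial φ) (h : ℝ≥0)
    {ι κ : Type} [Fintype ι] [Fintype κ] (x : ι → κ → ℝ) (c : ι → ℂ) {N : ℕ} (d : Fin N → ℂ) :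
    0 ≤ ∑ i, ∑ j, star (c i) * c j * ∑ k, ∑ l, star (d k) * d l *
      φ ((∑ a, ‖x i a - x j a‖₊ ^ 2) + if k = l then 0 else h) := by
  -- The `k`-th copy is displaced by `√(h / 2)` along the `k`-th new axis.
  have key := hφ (ι × Fin N) (κ ⊕ Fin N)
    (fun p => Sum.elim (x p.1) (Pi.single p.2 √((h : ℝ) / 2))) (fun p => c p.1 * d p.2)
  have hd : ∀ k l : Fin N, ∑ b, ‖(Pi.single k √((h : ℝ) / 2) : Fin N → ℝ) b -
      (Pi.single l √((h : ℝ) / 2) : Fin N → ℝ) b‖₊ ^ 2 = if k = l then 0 else h := by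
    intro k l
    split_ifs with hkl
    · subst hkl; simp
    · have hs : √((h : ℝ) / 2) ^ 2 = (h : ℝ) / 2 := Real.sq_sqrt (by positivity)
      apply NNReal.coe_injective
      push_cast
      have hb : ∀ b, (Pi.single k √((h : ℝ) / 2) : Fin N → ℝ) b -
          (Pi.single l √((h : ℝ) / 2) : Fin N → ℝ) b =
          (if b = k then √((h : ℝ) / 2) else 0) - (if b = l then √((h : ℝ) / 2) else 0) := by
        intro b; simp [Pi.single_apply]
      have hb2 : ∀ b, ‖(Pi.single k √((h : ℝ) / 2) : Fin N → ℝ) b -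
          (Pi.single l √((h : ℝ) / 2) : Fin N → ℝ) b‖ ^ 2 =
          (if b = k then (h : ℝ) / 2 else 0) + (if b = l then (h : ℝ) / 2 else 0) := by
        intro b
        rw [hb, Real.norm_eq_abs, sq_abs]
        split_ifs with h1 h2 h2
        · exact absurd (h1.symm.trans h2) hkl
        all_goals simp only [sub_zero, zero_sub, neg_sq, hs, add_zero, zero_add]
        simp
      simp only [hb2, Finset.sum_add_distrib, Finset.sum_ite_eq', Finset.mem_univ, if_true]
      simp
  convert key using 1
  simp only [Fintype.sum_prod_type, Fintype.sum_sum_type, Sum.elim_inl, Sum.elim_inr, hd,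
    Finset.mul_sum]
  refine Finset.sum_congr rfl fun i _ => ?_
  rw [Finset.sum_comm]
  refine Finset.sum_congr rfl fun k _ => Finset.sum_congr rfl fun j _ =>
    Finset.sum_congr rfl fun l _ => ?_
  simp only [star_mul']
  ring

theorem Complex.nonneg_of_ofReal_mul_nonneg {c : ℝ} (hc : 0 < c) {z : ℂ} (h : 0 ≤ (c : ℂ) * z) :
    0 ≤ z := by
  have h1 : (0 : ℂ) ≤ ((c⁻¹ : ℝ) : ℂ) := by exact_mod_cast (inv_pos.2 hc).le
  have h2 := mul_nonneg h1 h
  rwa [← mul_assoc, ← Complex.ofReal_mul, inv_mul_cancel₀ hc.ne', Complex.ofReal_one,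
    one_mul] at h2

/-- Two copies of every point with opposite coefficients `1, -1` leave the form of
`φ r - φ (r + h)`. -/
theorem IsPDRadial.sub_shift {φ : ℝ≥0 → ℂ} (hφ : IsPDRadial φ) (h : ℝ≥0) :
    IsPDRadial fun r => φ r - φ (r + h) := by
  intro ι κ _ _ x c
  have key := hφ.sum_copies_nonneg h x c (N := 2) ![1, -1]
  have e : ∀ s : ℝ≥0, ∑ k, ∑ l, star ((![1, -1] : Fin 2 → ℂ) k) * (![1, -1] : Fin 2 → ℂ) l *
      φ (s + if k = l then 0 else h) = 2 * (φ s - φ (s + h)) := by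
    intro s
    simp [Fin.sum_univ_two]
    ring
  simp only [e, mul_left_comm _ (2 : ℂ), ← Finset.mul_sum] at key
  exact Complex.nonneg_of_ofReal_mul_nonneg two_pos (by simpa only [Complex.ofReal_ofNat] using key)

/-- With `N` equally weighted copies of every point the diagonal terms have relative weight `1 / N`,
and only the form of `φ (r + h)` survives as `N → ∞`. -/
theorem IsPDRadial.shift {φ : ℝ≥0 → ℂ} (hφ : IsPDRadial φ) (h : ℝ≥0) :
    IsPDRadial fun r => φ (r + h) := by
  intro ι κ _ _ x c
  set D : ι → ι → ℝ≥0 := fun i j => ∑ a, ‖x i a - x j a‖₊ ^ 2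
  set A := ∑ i, ∑ j, star (c i) * c j * (φ (D i j) - φ (D i j + h))
  set B := ∑ i, ∑ j, star (c i) * c j * φ (D i j + h)
  have key : ∀ N : ℕ, 0 < N → 0 ≤ (((N : ℝ)⁻¹ : ℝ) : ℂ) * A + B := by
    intro N hN
    have h1 := hφ.sum_copies_nonneg h x c (N := N) (fun _ => 1)
    have e : ∀ s : ℝ≥0, ∑ k : Fin N, ∑ l : Fin N, star (1 : ℂ) * 1 *
        φ (s + if k = l then 0 else h) = N * (φ s - φ (s + h)) + N ^ 2 * φ (s + h) := by
      intro s
      have : ∀ k l : Fin N, φ (s + if k = l then 0 else h) =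
          (if k = l then φ s - φ (s + h) else 0) + φ (s + h) := by
        intro k l; split_ifs <;> simp
      simp only [this, star_one, mul_one, one_mul, Finset.sum_add_distrib, Finset.sum_ite_eq,
        Finset.mem_univ, if_true, Finset.sum_const, Finset.card_univ, Fintype.card_fin,
        nsmul_eq_mul]
      ring
    simp only [e] at h1
    have e2 : ∑ i, ∑ j, star (c i) * c j * ((N : ℂ) * (φ (D i j) - φ (D i j + h)) +
        (N : ℂ) ^ 2 * φ (D i j + h)) = (N : ℂ) ^ 2 * ((((N : ℝ)⁻¹ : ℝ) : ℂ) * A + B) := by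
      simp only [A, B, Finset.mul_sum, ← Finset.sum_add_distrib]
      refine Finset.sum_congr rfl fun i _ => Finset.sum_congr rfl fun j _ => ?_
      have : (N : ℂ) ≠ 0 := by exact_mod_cast hN.ne'
      push_cast
      field_simp
    rw [e2] at h1
    exact Complex.nonneg_of_ofReal_mul_nonneg (c := (N : ℝ) ^ 2) (by positivity)
      (by simpa only [Complex.ofReal_pow, Complex.ofReal_natCast] using h1)
  have hlim : Tendsto (fun N : ℕ => (((N : ℝ)⁻¹ : ℝ) : ℂ) * A + B) atTop (𝓝 B) := by
    have h0 : Tendsto (fun N : ℕ => (((N : ℝ)⁻¹ : ℝ) : ℂ)) atTop (𝓝 0) := by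
      have := (Complex.continuous_ofReal.tendsto 0).comp tendsto_inv_atTop_nhds_zero_nat
      simpa [Function.comp_def] using this
    simpa using (h0.mul_const A).add_const B
  refine ge_of_tendsto hlim ?_
  filter_upwards [eventually_gt_atTop 0] with N hN using key N hN

theorem IsPDRadial.apply_zero_nonneg {φ : ℝ≥0 → ℂ} (hφ : IsPDRadial φ) : 0 ≤ φ 0 := by
  simpa using hφ Unit Unit (fun _ _ => 0) (fun _ => 1)

theorem IsPDRadial.nonneg {φ : ℝ≥0 → ℂ} (hφ : IsPDRadial φ) (r : ℝ≥0) : 0 ≤ φ r := by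
  simpa using (hφ.shift r).apply_zero_nonneg

theorem IsPDRadial.antitone {φ : ℝ≥0 → ℂ} (hφ : IsPDRadial φ) : Antitone φ := by
  intro r s hrs
  have := (hφ.sub_shift (s - r)).nonneg r
  rwa [add_tsub_cancel_of_le hrs, sub_nonneg] at this

/-- The values of a radially positive definite function on an arithmetic progression form a
completely monotone sequence. -/
theorem IsPDRadial.momentFunctional_nonneg (h : ℝ≥0) (k l : ℕ) {φ : ℝ≥0 → ℂ} (hφ : IsPDRadial φ) :
    0 ≤ momentFunctional (fun n : ℕ => φ (n * h)) (X ^ k * (1 - X) ^ l) := by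
  induction k generalizing φ with
  | succ k ih =>
    have := ih (hφ.shift h)
    rw [pow_succ', mul_assoc, momentFunctional_X_mul]
    simpa only [Nat.cast_succ, add_mul, one_mul] using this
  | zero =>
    simp only [pow_zero, one_mul]
    induction l generalizing φ with
    | zero =>
      rw [pow_zero, ← pow_zero X, momentFunctional_X_pow]
      exact hφ.nonneg _
    | succ l ih =>
      have := ih (hφ.sub_shift h)
      have e : ∀ p : ℂ[X], momentFunctional (fun n : ℕ => φ (n * h) - φ (n * h + h)) p
          = momentFunctional (fun n : ℕ => φ (n * h)) p
            - momentFunctional (fun n : ℕ => φ ((n + 1 : ℕ) * h)) p := by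
        intro p
        rw [← LinearMap.sub_apply]
        congr 1
        apply Polynomial.lhom_ext'
        intro n
        ext
        simp only [LinearMap.comp_apply, ← X_pow_eq_monomial, LinearMap.sub_apply,
          momentFunctional_X_pow]
        simp [add_mul]
      have e' := momentFunctional_X_mul (fun n : ℕ => φ (n * h)) ((1 - X) ^ l)
      rw [e, ← e', ← map_sub] at this
      rwa [pow_succ', sub_mul, one_mul]

theorem momentFunctional_comp {E E' : Type*} [AddCommGroup E] [Module ℂ E] [AddCommGroup E']
    [Module ℂ E'] (ℓ : E →ₗ[ℂ] E') (a : ℕ → E) (p : ℂ[X]) :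
    ℓ (momentFunctional a p) = momentFunctional (fun n => ℓ (a n)) p := by
  rw [← LinearMap.comp_apply]
  congr 1
  apply Polynomial.lhom_ext'
  intro n
  ext
  simp only [LinearMap.comp_apply, ← X_pow_eq_monomial, momentFunctional_X_pow]

/-! ### The operator valued Bernstein theorem -/

/-- The power `x ^ r` as a continuous function on the unit interval; it is the constant `1` for
`r = 0`. -/
noncomputable def rpowI (r : ℝ≥0) : C(I, ℂ) :=
  ⟨fun x => (((x : ℝ) ^ (r : ℝ) : ℝ) : ℂ),
    Complex.continuous_ofReal.comp
      ((Real.continuous_rpow_const r.2).comp continuous_subtype_val)⟩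

theorem rpowI_apply (r : ℝ≥0) (x : I) : rpowI r x = (((x : ℝ) ^ (r : ℝ) : ℝ) : ℂ) := rfl

theorem polyI_X_pow (k : ℕ) : polyI (X ^ k) = rpowI k := by
  ext x
  simp [polyI, rpowI_apply]

/-- Norm continuity fails at `r = 0`, where `x ^ r` converges to `1` only for `x ≠ 0`. -/
theorem continuousOn_rpowI : ContinuousOn rpowI (Set.Ioi 0) := by
  rw [continuousOn_iff_continuous_domRestrict]
  have h : Continuous fun p : Set.Ioi (0 : ℝ≥0) × I =>
      (((p.2 : ℝ) ^ ((p.1 : ℝ≥0) : ℝ) : ℝ) : ℂ) := by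
    refine Complex.continuous_ofReal.comp (continuous_iff_continuousAt.2 fun p => ?_)
    have hp : (0 : ℝ) < ((p.1 : ℝ≥0) : ℝ) := by exact_mod_cast p.1.2
    exact (Real.continuousAt_rpow_of_pos ((p.2 : ℝ), ((p.1 : ℝ≥0) : ℝ)) hp).comp
      (f := fun p : Set.Ioi (0 : ℝ≥0) × I => ((p.2 : ℝ), ((p.1 : ℝ≥0) : ℝ))) (by fun_prop)
  exact (ContinuousMap.curry ⟨_, h⟩).continuous

section OperatorBernstein

variable {H : Type*} [NormedAddCommGroup H] [InnerProductSpace ℂ H] [CompleteSpace H]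

theorem exists_completelyPositive_of_isPDRadial {G : ℝ≥0 → H →L[ℂ] H}
    (hG : ∀ v, IsPDRadial fun r => inner ℂ v (G r v)) (h : ℝ≥0) :
    ∃ Λ : C(I, ℂ) →L[ℂ] H →L[ℂ] H, IsCompletelyPositive Λ ∧ ∀ k : ℕ, Λ (rpowI k) = G (k * h) := by
  obtain ⟨Λ, h1, h2⟩ := exists_completelyPositive_extension
    (L := momentFunctional fun n : ℕ => G (n * h)) (fun k l v => by
      have := momentFunctional_comp
        ((innerSL ℂ v).toLinearMap ∘ₗ (ContinuousLinearMap.apply ℂ H v).toLinearMap)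
        (fun n : ℕ => G (n * h)) (X ^ k * (1 - X) ^ l)
      have h' := (hG v).momentFunctional_nonneg h k l
      simp only [LinearMap.comp_apply, ContinuousLinearMap.coe_coe,
        ContinuousLinearMap.apply_apply, innerSL_apply_apply] at this
      rwa [this])
  refine ⟨Λ, h2, fun k => ?_⟩
  rw [← polyI_X_pow, h1, momentFunctional_X_pow]

/-- The operator valued Bernstein theorem: a weakly continuous function of the squared distance
whose quadratic forms are positive definite in all dimensions is `r ↦ Λ(x ^ r)` for a completely
positive map `Λ`. The maps obtained from the grids of mesh `1 / N` all agree, so that `Λ` is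
determined at rational exponents, and continuity gives the others. -/
theorem exists_completelyPositive_rpowI {G : ℝ≥0 → H →L[ℂ] H}
    (hG : ∀ v, IsPDRadial fun r => inner ℂ v (G r v))
    (hc : ∀ u v, Continuous fun r => inner ℂ v (G r u)) :
    ∃ Λ : C(I, ℂ) →L[ℂ] H →L[ℂ] H, IsCompletelyPositive Λ ∧ ∀ r, Λ (rpowI r) = G r := by
  obtain ⟨Λ, hΛ, hΛ1⟩ := exists_completelyPositive_of_isPDRadial hG 1
  refine ⟨Λ, hΛ, ?_⟩
  have grid : ∀ k N : ℕ, 0 < N → Λ (rpowI (k / N)) = G (k / N) := by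
    intro k N hN
    have hN' : (N : ℝ≥0) ≠ 0 := by exact_mod_cast hN.ne'
    -- The map of the grid of mesh `1 / N` gives back `Λ` after the substitution `x ↦ x ^ N`, as
    -- both have the same moments.
    obtain ⟨Λ', -, hΛ'⟩ := exists_completelyPositive_of_isPDRadial hG (N : ℝ≥0)⁻¹
    let q : C(I, I) := ⟨fun x => x ^ N, by fun_prop⟩
    have hq : ∀ g : C(I, ℂ), Λ g = Λ' (g.comp q) := by
      have hcont : Continuous fun g : C(I, ℂ) => Λ' (g.comp q) :=
        Λ'.continuous.comp (ContinuousMap.continuous_precomp q)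
      intro g
      refine congrFun (denseRange_polyI.equalizer Λ.continuous hcont ?_) g
      funext p
      simp only [Function.comp_apply]
      induction p using Polynomial.induction_on' with
      | add p p' hp hp' =>
        rw [map_add, map_add, hp, hp', ← map_add]
        rfl
      | monomial n c =>
        rw [← mul_one c, ← smul_eq_mul, ← smul_monomial, ← X_pow_eq_monomial, map_smul, map_smul,
          polyI_X_pow, hΛ1]
        have : (c • rpowI n).comp q = c • rpowI ((n * N : ℕ) : ℝ≥0) := by
          ext x
          simp only [ContinuousMap.comp_apply, ContinuousMap.smul_apply, rpowI_apply]
          congr 2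
          simp only [q, ContinuousMap.coe_mk, NNReal.coe_natCast, Real.rpow_natCast]
          rw [mul_comm, pow_mul]
          rfl
        rw [this, map_smul, hΛ']
        congr 2
        push_cast
        field_simp
    rw [hq]
    have : (rpowI (k / N)).comp q = rpowI k := by
      ext x
      simp only [ContinuousMap.comp_apply, rpowI_apply]
      congr 1
      have : ((q x : I) : ℝ) = (x : ℝ) ^ (N : ℝ) := by
        rw [Real.rpow_natCast]; rfl
      rw [this, ← Real.rpow_mul x.2.1]
      congr 1
      push_cast
      have : (N : ℝ) ≠ 0 := by exact_mod_cast hN.ne'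
      field_simp
    rw [this, hΛ', div_eq_mul_inv]
  intro r
  rcases eq_or_ne r 0 with rfl | hr
  · simpa using hΛ1 0
  · have hr' : 0 < r := pos_iff_ne_zero.2 hr
    have ht : Tendsto (fun n : ℕ => ((⌈(r : ℝ) * n⌉₊ : ℝ≥0) / n : ℝ≥0)) atTop (𝓝 r) := by
      rw [← NNReal.tendsto_coe]
      have := (tendsto_nat_ceil_mul_div_atTop (R := ℝ) r.2).comp
        (tendsto_natCast_atTop_atTop (R := ℝ))
      simpa [Function.comp_def] using this
    have h1 : Tendsto (fun n : ℕ => rpowI ((⌈(r : ℝ) * n⌉₊ : ℝ≥0) / n)) atTop (𝓝 (rpowI r)) :=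
      (continuousOn_rpowI.continuousAt (Ioi_mem_nhds hr')).tendsto.comp ht
    ext u
    refine ext_inner_left ℂ fun v => ?_
    have h2 := ((innerSL ℂ v).continuous.tendsto _).comp
      (((ContinuousLinearMap.apply ℂ H u).continuous.tendsto _).comp
        ((Λ.continuous.tendsto _).comp h1))
    have h3 := ((hc u v).tendsto r).comp ht
    refine tendsto_nhds_unique_of_eventuallyEq h2 h3 ?_
    filter_upwards [eventually_gt_atTop 0] with n hn
    simp [grid _ n hn]

end OperatorBernstein

/-! ### Gaussian kernels -/

/-- A Gaussian is the Fourier transform of a Gaussian, so the quadratic form is the integral of a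
squared modulus against a positive weight. -/
theorem gaussian_sum_nonneg {V ι : Type*} [NormedAddCommGroup V] [InnerProductSpace ℝ V]
    [FiniteDimensional ℝ V] [MeasurableSpace V] [BorelSpace V] [Fintype ι] {w : ℝ} (hw : 0 < w)
    (x : ι → V) (c : ι → ℂ) :
    0 ≤ ∑ i, ∑ j, star (c i) * c j * ((Real.exp (-w * ‖x i - x j‖ ^ 2) : ℝ) : ℂ) := by
  set b : ℝ := 1 / (4 * w) with hb
  have hb0 : 0 < b := by positivity
  have hb' : 0 < (b : ℂ).re := by simpa using hb0
  set C : ℝ := (Real.pi / b) ^ ((Module.finrank ℝ V : ℝ) / 2) with hC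
  have hC0 : 0 < C := by positivity
  have e1 : ∀ u : V, (C : ℂ) * ((Real.exp (-w * ‖u‖ ^ 2) : ℝ) : ℂ) =
      ∫ v : V, Complex.exp (-b * ‖v‖ ^ 2 + Complex.I * (inner ℝ u v : ℝ)) := by
    intro u
    rw [GaussianFourier.integral_cexp_neg_mul_sq_norm_add hb', hC,
      Complex.ofReal_cpow (by positivity)]
    push_cast
    congr 2
    rw [Complex.I_sq, hb]
    push_cast
    field_simp
  have hint : ∀ u : V, Integrable fun v : V =>
      Complex.exp (-b * ‖v‖ ^ 2 + Complex.I * (inner ℝ u v : ℝ)) := fun u =>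
    GaussianFourier.integrable_cexp_neg_mul_sq_norm_add hb' Complex.I u
  refine Complex.nonneg_of_ofReal_mul_nonneg hC0 ?_
  have e2 : (C : ℂ) * ∑ i, ∑ j, star (c i) * c j * ((Real.exp (-w * ‖x i - x j‖ ^ 2) : ℝ) : ℂ) =
      ∫ v : V, ((Real.exp (-b * ‖v‖ ^ 2) *
        ‖∑ j, c j * Complex.exp (-Complex.I * (inner ℝ (x j) v : ℝ))‖ ^ 2 : ℝ) : ℂ) := by
    have e3 : (C : ℂ) * ∑ i, ∑ j, star (c i) * c j *
        ((Real.exp (-w * ‖x i - x j‖ ^ 2) : ℝ) : ℂ) = ∑ i, ∑ j, ∫ v : V, star (c i) * c j *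
          Complex.exp (-b * ‖v‖ ^ 2 + Complex.I * (inner ℝ (x i - x j) v : ℝ)) := by
      simp only [Finset.mul_sum]
      refine Finset.sum_congr rfl fun i _ => Finset.sum_congr rfl fun j _ => ?_
      rw [integral_const_mul, ← e1]
      ring
    rw [e3, Finset.sum_congr rfl fun i _ => (integral_finsetSum _ fun j _ =>
      (hint (x i - x j)).const_mul _).symm, ← integral_finsetSum _ fun i _ =>
      integrable_finsetSum _ fun j _ => (hint (x i - x j)).const_mul _]
    refine integral_congr_ae (Eventually.of_forall fun v => ?_)
    simp only
    rw [Complex.ofReal_mul, Complex.ofReal_pow, ← Complex.conj_mul', map_sum, Finset.sum_mul_sum,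
      Finset.mul_sum]
    refine Finset.sum_congr rfl fun i _ => ?_
    rw [Finset.mul_sum]
    refine Finset.sum_congr rfl fun j _ => ?_
    rw [map_mul, ← Complex.exp_conj, inner_sub_left, Complex.exp_add]
    simp only [map_mul, map_neg, Complex.conj_I, Complex.conj_ofReal, neg_neg]
    have : Complex.exp (Complex.I * ((inner ℝ (x i) v - inner ℝ (x j) v : ℝ) : ℂ)) =
        Complex.exp (Complex.I * (inner ℝ (x i) v : ℝ)) *
          Complex.exp (-Complex.I * (inner ℝ (x j) v : ℝ)) := by
      rw [← Complex.exp_add]; push_cast; ring_nf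
    rw [this, Complex.ofReal_exp]
    push_cast
    simp only [RCLike.star_def]
    ring
  rw [e2, integral_complex_ofReal]
  exact_mod_cast integral_nonneg fun v => by positivity

/-- For `0 < x < 1` the entries are `exp(-w |yᵢ - yⱼ|²)` with `w = -log x`; at `x = 1` all entries
are `1`, and at `x = 0` the matrix is the identity because the points are distinct. -/
theorem posSemidef_rpowI {V ι : Type*} [NormedAddCommGroup V] [InnerProductSpace ℝ V]
    [FiniteDimensional ℝ V] [MeasurableSpace V] [BorelSpace V] [Fintype ι] {y : ι → V}
    (hy : Function.Injective y) (x : I) :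
    (Matrix.of fun i j => rpowI (‖y i - y j‖₊ ^ 2) x).PosSemidef := by
  classical
  have herm : (Matrix.of fun i j => rpowI (‖y i - y j‖₊ ^ 2) x).IsHermitian := by
    ext i j
    simp only [Matrix.conjTranspose_apply, Matrix.of_apply, rpowI_apply, RCLike.star_def,
      Complex.conj_ofReal]
    rw [← nnnorm_neg, neg_sub]
  have quad : ∀ c : ι → ℂ, star c ⬝ᵥ (Matrix.of fun i j => rpowI (‖y i - y j‖₊ ^ 2) x).mulVec c =
      ∑ i, ∑ j, star (c i) * c j * rpowI (‖y i - y j‖₊ ^ 2) x := by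
    intro c
    simp only [dotProduct, Matrix.mulVec, Finset.mul_sum, Matrix.of_apply, Pi.star_apply]
    refine Finset.sum_congr rfl fun i _ => Finset.sum_congr rfl fun j _ => by ring
  refine Matrix.posSemidef_iff_dotProduct_mulVec.2 ⟨herm, fun c => ?_⟩
  rw [quad]
  rcases eq_or_lt_of_le x.2.1 with h0 | h0
  · -- at `x = 0` the matrix is the identity, because the points are distinct
    have : ∀ i j, rpowI (‖y i - y j‖₊ ^ 2) x = if i = j then 1 else 0 := by
      intro i j
      rw [rpowI_apply, ← h0]
      split_ifs with h
      · subst h; simp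
      · have h' : y i - y j ≠ 0 := sub_ne_zero.2 (hy.ne h)
        rw [Real.zero_rpow (by simpa using h'), Complex.ofReal_zero]
    simp only [this, mul_ite, mul_one, mul_zero, Finset.sum_ite_eq, Finset.mem_univ, if_true]
    exact Finset.sum_nonneg fun i _ => star_mul_self_nonneg _
  rcases eq_or_lt_of_le x.2.2 with h1 | h1
  · have : ∀ i j, rpowI (‖y i - y j‖₊ ^ 2) x = 1 := by
      intro i j
      rw [rpowI_apply, h1, Real.one_rpow, Complex.ofReal_one]
    simp only [this, mul_one, ← Finset.mul_sum, ← Finset.sum_mul]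
    rw [← star_sum]
    exact star_mul_self_nonneg _
  · have hw : 0 < -Real.log x := neg_pos.2 (Real.log_neg h0 h1)
    have := gaussian_sum_nonneg hw y c
    simp only [rpowI_apply]
    convert this using 6 with i _ j _
    rw [Real.rpow_def_of_pos h0, neg_neg]
    simp

/-! ### Functions in the reproducing kernel Hilbert space -/

section RKHSFunctions

variable {X H : Type*} [NormedAddCommGroup H] [InnerProductSpace ℂ H] [CompleteSpace H]
  {K : X → X → H →L[ℂ] H}

theorem IsPDKernel.fact (hK : IsPDKernel K) : Fact (Matrix.of K).PosSemidef := ⟨hK.posSemidef⟩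

variable (hK : IsPDKernel K)

theorem mem_rkhsFunctions_iff [Fact (Matrix.of K).PosSemidef] {f : X → H} :
    f ∈ rkhsFunctions hK ↔ ∃ φ : RKHS.OfKernel (Matrix.of K), (φ : X → H) = f := Iff.rfl

theorem kerFun_ofKernel_apply [Fact (Matrix.of K).PosSemidef] (x y : X) (v : H) :
    RKHS.kerFun (RKHS.OfKernel (Matrix.of K)) y v x = K x y v := by
  rw [RKHS.kerFun_apply, RKHS.OfKernel.kernel_ofKernel, Matrix.of_apply]

theorem kernel_section_mem_rkhsFunctions (y : X) (v : H) :
    (fun x => K x y v) ∈ rkhsFunctions hK := by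
  have := hK.fact
  exact (mem_rkhsFunctions_iff hK).2 ⟨RKHS.kerFun _ y v,
    funext fun x => kerFun_ofKernel_apply x y v⟩

theorem sum_mem_rkhsFunctions {ι : Type*} {s : Finset ι} {f : ι → X → H}
    (hf : ∀ i ∈ s, f i ∈ rkhsFunctions hK) : (fun x => ∑ i ∈ s, f i x) ∈ rkhsFunctions hK := by
  classical
  have := hK.fact
  induction s using Finset.induction_on with
  | empty => exact (mem_rkhsFunctions_iff hK).2 ⟨0, by funext x; simp⟩
  | insert a s ha ih =>
    obtain ⟨φ, hφ⟩ := (mem_rkhsFunctions_iff hK).1 (hf a (Finset.mem_insert_self a s))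
    obtain ⟨ψ, hψ⟩ := (mem_rkhsFunctions_iff hK).1
      (ih fun i hi => hf i (Finset.mem_insert_of_mem hi))
    refine (mem_rkhsFunctions_iff hK).2 ⟨φ + ψ, ?_⟩
    funext x
    rw [RKHS.coe_add, Pi.add_apply, hφ, hψ, Finset.sum_insert ha]

/-- A property of functions that passes to linear combinations and uniform limits holds on the
whole space as soon as it holds for the kernel sections, if the kernel is bounded on the
diagonal. -/
theorem rkhsFunctions_induction {C : ℝ} (hC : ∀ x, ‖K x x‖ ≤ C) {P : (X → H) → Prop}
    (hsec : ∀ y v, P fun x => K x y v) (hzero : P 0) (hadd : ∀ f g, P f → P g → P (f + g))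
    (hsmul : ∀ (c : ℂ) f, P f → P (c • f))
    (hlim : ∀ f, (∀ ε : ℝ, 0 < ε → ∃ g, P g ∧ ∀ x, ‖f x - g x‖ < ε) → P f) :
    ∀ f ∈ rkhsFunctions hK, P f := by
  have := hK.fact
  intro f hf
  obtain ⟨φ, rfl⟩ := (mem_rkhsFunctions_iff hK).1 hf
  have hspan : ∀ ψ ∈ Submodule.span ℂ
      {RKHS.kerFun (RKHS.OfKernel (Matrix.of K)) x v | (x) (v)}, P ψ := by
    intro ψ hψ
    induction hψ using Submodule.span_induction with
    | mem ψ h =>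
      obtain ⟨y, v, rfl⟩ := h
      convert hsec y v using 1
      exact funext fun x => kerFun_ofKernel_apply x y v
    | zero => rw [RKHS.coe_zero]; exact hzero
    | add a b _ _ ha hb => rw [RKHS.coe_add]; exact hadd _ _ ha hb
    | smul c a _ ha => rw [RKHS.coe_smul]; exact hsmul _ _ ha
  refine hlim _ fun ε hε => ?_
  have hmem : φ ∈ closure ((Submodule.span ℂ
      {RKHS.kerFun (RKHS.OfKernel (Matrix.of K)) x v | (x) (v)} : Submodule ℂ _) : Set _) := by
    rw [← Submodule.topologicalClosure_coe, RKHS.kerFun_dense]; trivial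
  obtain ⟨ψ, hψ, hd⟩ := Metric.mem_closure_iff.1 hmem (ε / (√C + 1)) (by positivity)
  refine ⟨ψ, hspan ψ hψ, fun x => ?_⟩
  rw [← Pi.sub_apply, ← RKHS.coe_sub]
  refine (RKHS.norm_apply_le _ x).trans_lt ?_
  rw [RKHS.OfKernel.kernel_ofKernel, Matrix.of_apply]
  rw [dist_eq_norm] at hd
  have h1 : √‖K x x‖ ≤ √C := Real.sqrt_le_sqrt (hC x)
  calc _ ≤ ‖φ - ψ‖ * (√C + 1) := by gcongr; linarith
    _ < ε / (√C + 1) * (√C + 1) := by gcongr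
    _ = ε := by field_simp

/-- If the quadratic form of the kernel vanishes, then the element `∑ᵢ K(·, xᵢ) vᵢ` is zero, and the
reproducing property annihilates all functions of the space. -/
theorem sum_inner_eq_zero_of_quadratic_form_eq_zero {ι : Type*} [Fintype ι] {x : ι → X} {v : ι → H}
    (h0 : ∑ i, ∑ j, inner ℂ (v i) (K (x i) (x j) (v j)) = 0) {f : X → H}
    (hf : f ∈ rkhsFunctions hK) : ∑ i, inner ℂ (v i) (f (x i)) = 0 := by
  have := hK.fact
  obtain ⟨φ, rfl⟩ := (mem_rkhsFunctions_iff hK).1 hf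
  set e := ∑ i, RKHS.kerFun (RKHS.OfKernel (Matrix.of K)) (x i) (v i) with he
  have h1 : inner ℂ e e = (0 : ℂ) := by
    rw [← h0, he, sum_inner]
    refine Finset.sum_congr rfl fun i _ => ?_
    rw [inner_sum]
    refine Finset.sum_congr rfl fun j _ => ?_
    rw [RKHS.kerFun_inner, kerFun_ofKernel_apply]
  have h2 : e = 0 := inner_self_eq_zero.1 h1
  have h3 : inner ℂ e φ = (0 : ℂ) := by rw [h2, inner_zero_left]
  rw [he, sum_inner] at h3
  simpa only [RKHS.kerFun_inner] using h3

/-- Superpositions of kernel sections, formed as Bochner integrals in the Hilbert space. -/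
theorem integral_smul_kernel_mem_rkhsFunctions [MeasurableSpace X] [TopologicalSpace X]
    [OpensMeasurableSpace X] [SecondCountableTopology X] {μ : Measure X} {C : ℝ}
    (hC : ∀ x, ‖K x x‖ ≤ C) {v : H}
    (hcont : Continuous fun q : X × X => inner ℂ v (K q.1 q.2 v))
    {p : X → ℂ} (hp : Integrable p μ) :
    (fun x => ∫ y, p y • K x y v ∂μ) ∈ rkhsFunctions hK := by
  have := hK.fact
  set k : X → RKHS.OfKernel (Matrix.of K) := fun y => RKHS.kerFun _ y v with hk
  have hin : ∀ y z, inner ℂ (k y) (k z) = inner ℂ v (K y z v) := fun y z => by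
    rw [hk, RKHS.kerFun_inner, kerFun_ofKernel_apply]
  have hkc : Continuous k := by
    refine continuous_iff_continuousAt.2 fun z => ?_
    rw [ContinuousAt, tendsto_iff_norm_sub_tendsto_zero]
    have hsq : Tendsto (fun y => ‖k y - k z‖ ^ 2) (𝓝 z) (𝓝 0) := by
      have e : ∀ y, ‖k y - k z‖ ^ 2 = (inner ℂ v (K y y v) - inner ℂ v (K y z v)
          - inner ℂ v (K z y v) + inner ℂ v (K z z v)).re := by
        intro y
        rw [← inner_self_eq_norm_sq (𝕜 := ℂ), inner_sub_left, inner_sub_right, inner_sub_right,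
          hin, hin, hin, hin, sub_sub_eq_add_sub, sub_add_eq_add_sub, RCLike.re_eq_complex_re]
        congr 1
        ring
      have h1 : Continuous fun y => (inner ℂ v (K y y v) - inner ℂ v (K y z v)
          - inner ℂ v (K z y v) + inner ℂ v (K z z v)).re := by
        refine Complex.continuous_re.comp (((Continuous.sub ?_ ?_).sub ?_).add continuous_const)
        · exact hcont.comp (continuous_id.prodMk continuous_id)
        · exact hcont.comp (continuous_id.prodMk continuous_const)
        · exact hcont.comp (continuous_const.prodMk continuous_id)
      simp only [e]
      simpa using h1.tendsto z
    have := hsq.sqrt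
    simpa using this
  have hkb : ∀ y, ‖k y‖ ≤ √C * ‖v‖ := by
    intro y
    refine (ContinuousLinearMap.le_opNorm _ _).trans ?_
    rw [RKHS.norm_kerFun_eq_sqrt_norm_kernel, RKHS.OfKernel.kernel_ofKernel, Matrix.of_apply]
    gcongr
    exact hC y
  have hint : Integrable (fun y => p y • k y) μ := by
    refine Integrable.mono' (hp.norm.mul_const (√C * ‖v‖))
      (hp.aestronglyMeasurable.smul hkc.aestronglyMeasurable) (Eventually.of_forall fun y => ?_)
    rw [norm_smul]
    gcongr
    exact hkb y
  refine (mem_rkhsFunctions_iff hK).2 ⟨∫ y, p y • k y ∂μ, ?_⟩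
  funext x
  rw [← RKHS.adjoint_kerFun, ← ContinuousLinearMap.integral_comp_comm _ hint]
  refine integral_congr_ae (Eventually.of_forall fun y => ?_)
  simp only [map_smul]
  rw [RKHS.adjoint_kerFun, hk, kerFun_ofKernel_apply]

end RKHSFunctions

/-! ### Strict positive definiteness and interpolation -/

section Strict

variable {X H : Type*} [NormedAddCommGroup H] [InnerProductSpace ℂ H] [CompleteSpace H]
  {K : X → X → H →L[ℂ] H}

/-- If the quadratic form vanishes at `(xᵢ, vᵢ)`, then `∑ᵢ ⟨vᵢ, f(xᵢ)⟩ = 0` for all functions of the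
space; functions with `f(xᵢ)` close to `vᵢ` then give `∑ᵢ ‖vᵢ‖² = 0`. -/
theorem isStrictlyPDKernel_of_interpolation (hK : IsPDKernel K)
    (h : ∀ (n : ℕ) (x : Fin n → X) (v : Fin n → H), Function.Injective x → ∀ ε : ℝ, 0 < ε →
      ∃ f ∈ rkhsFunctions hK, ∀ i, ‖f (x i) - v i‖ < ε) : IsStrictlyPDKernel K := by
  refine ⟨hK, fun n x v hx h0 => ?_⟩
  have key : ∀ ε : ℝ, 0 < ε → ∑ i, ‖v i‖ ^ 2 ≤ ε * ∑ i, ‖v i‖ := by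
    intro ε hε
    obtain ⟨f, hf, hfv⟩ := h n x v hx ε hε
    have h1 := sum_inner_eq_zero_of_quadratic_form_eq_zero hK h0 hf
    have h2 : ((∑ i, ‖v i‖ ^ 2 : ℝ) : ℂ) = ∑ i, inner ℂ (v i) (v i - f (x i)) := by
      simp only [inner_sub_right, Finset.sum_sub_distrib, h1, sub_zero]
      push_cast
      exact Finset.sum_congr rfl fun i _ => (inner_self_eq_norm_sq_to_K (𝕜 := ℂ) (v i)).symm
    calc ∑ i, ‖v i‖ ^ 2 = ‖((∑ i, ‖v i‖ ^ 2 : ℝ) : ℂ)‖ := by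
          rw [Complex.norm_real, Real.norm_of_nonneg (by positivity)]
      _ ≤ ∑ i, ‖v i‖ * ε := by
          rw [h2]
          refine (norm_sum_le _ _).trans (Finset.sum_le_sum fun i _ => ?_)
          refine (norm_inner_le_norm _ _).trans ?_
          gcongr
          rw [norm_sub_rev]
          exact (hfv i).le
      _ = _ := by rw [← Finset.sum_mul, mul_comm]
  have hle : ∑ i, ‖v i‖ ^ 2 ≤ 0 := by
    have hlim : Tendsto (fun ε : ℝ => ε * ∑ i, ‖v i‖) (𝓝[>] 0) (𝓝 0) := by
      have : Tendsto (fun ε : ℝ => ε * ∑ i, ‖v i‖) (𝓝 0) (𝓝 (0 * ∑ i, ‖v i‖)) :=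
        tendsto_id.mul_const _
      rw [zero_mul] at this
      exact this.mono_left nhdsWithin_le_nhds
    refine ge_of_tendsto hlim ?_
    filter_upwards [self_mem_nhdsWithin] with ε hε using key ε hε
  have hz := (Finset.sum_eq_zero_iff_of_nonneg fun i _ => by positivity).1
    (le_antisymm hle (Finset.sum_nonneg fun i _ => by positivity))
  intro i
  simpa using hz i (Finset.mem_univ i)

theorem IsUniversalKernel.isStrictlyPDKernel [TopologicalSpace X] [T1Space X]
    (h : IsUniversalKernel K) : IsStrictlyPDKernel K := by
  obtain ⟨hK, -, h⟩ := h
  refine isStrictlyPDKernel_of_interpolation hK fun n x v hx ε hε => ?_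
  have hfin : (Set.range x).Finite := Set.finite_range x
  have : Finite (Set.range x) := hfin
  obtain ⟨f, hf, hfg⟩ := h (Set.range x) hfin.isCompact
    (fun y => v ((Equiv.ofInjective x hx).symm y)) continuous_of_discreteTopology ε hε
  refine ⟨f, hf, fun i => ?_⟩
  have := hfg ⟨x i, i, rfl⟩
  have e : (Equiv.ofInjective x hx).symm ⟨x i, i, rfl⟩ = i := Equiv.ofInjective_symm_apply hx i
  simpa only [e] using this

theorem isCZero_of_hasCompactSupport {Y E : Type*} [TopologicalSpace Y] [NormedAddCommGroup E]
    {f : Y → E} (hf : Continuous f) (hc : HasCompactSupport f) : IsCZero f := by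
  refine ⟨hf, fun ε hε => ⟨tsupport f, hc, fun y hy => ?_⟩⟩
  rw [image_eq_zero_of_notMem_tsupport hy, norm_zero]
  exact hε

theorem IsCZeroUniversalKernel.isStrictlyPDKernel [TopologicalSpace X] [T2Space X]
    [LocallyCompactSpace X] (h : IsCZeroUniversalKernel K) : IsStrictlyPDKernel K := by
  obtain ⟨hK, -, h⟩ := h
  refine isStrictlyPDKernel_of_interpolation hK fun n x v hx ε hε => ?_
  have hb : ∀ i, ∃ b : C(X, ℝ), HasCompactSupport b ∧ b (x i) = 1 ∧ ∀ j, j ≠ i → b (x j) = 0 := by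
    intro i
    have hfin : (x '' {j | j ≠ i}).Finite := Set.toFinite _
    obtain ⟨b, h1, h0, hc, -⟩ := exists_continuous_one_zero_of_isCompact
      (isCompact_singleton (x := x i)) hfin.isClosed (by
        rw [Set.disjoint_singleton_left]
        rintro ⟨j, hj, e⟩
        exact hj (hx e))
    exact ⟨b, hc, h1 rfl, fun j hj => h0 ⟨j, hj, rfl⟩⟩
  choose b hbc hb1 hb0 using hb
  obtain ⟨f, hf, hfg⟩ := h (fun y => ∑ i, b i y • v i)
    (isCZero_of_hasCompactSupport (by fun_prop) (by
      refine HasCompactSupport.intro (K := ⋃ i, tsupport (b i))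
        (isCompact_iUnion fun i => hbc i) fun y hy => ?_
      refine Finset.sum_eq_zero fun i _ => ?_
      rw [image_eq_zero_of_notMem_tsupport fun h => hy (Set.mem_iUnion.2 ⟨i, h⟩), zero_smul])) ε hε
  refine ⟨f, hf, fun i => ?_⟩
  have e : ∑ j, b j (x i) • v j = v i := by
    rw [Finset.sum_eq_single i (fun j _ hj => by rw [hb0 j i hj.symm, zero_smul]) (by simp), hb1,
      one_smul]
  simpa only [e] using hfg (x i)

end Strict

/-! ### Functions vanishing at infinity -/

section CZero

variable {Y E : Type*} [TopologicalSpace Y] [NormedAddCommGroup E]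

theorem isCZero_zero : IsCZero (0 : Y → E) :=
  ⟨continuous_zero, fun ε hε => ⟨∅, isCompact_empty, fun y _ => by simpa using hε⟩⟩

theorem IsCZero.add {f g : Y → E} (hf : IsCZero f) (hg : IsCZero g) : IsCZero (f + g) := by
  refine ⟨hf.1.add hg.1, fun ε hε => ?_⟩
  obtain ⟨A, hA, h1⟩ := hf.2 (ε / 2) (by positivity)
  obtain ⟨B, hB, h2⟩ := hg.2 (ε / 2) (by positivity)
  refine ⟨A ∪ B, hA.union hB, fun y hy => ?_⟩
  rw [Set.mem_union, not_or] at hy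
  calc _ ≤ ‖f y‖ + ‖g y‖ := norm_add_le _ _
    _ < ε / 2 + ε / 2 := add_lt_add (h1 y hy.1) (h2 y hy.2)
    _ = ε := add_halves ε

theorem IsCZero.smul [NormedSpace ℂ E] {f : Y → E} (c : ℂ) (hf : IsCZero f) :
    IsCZero (c • f) := by
  refine ⟨hf.1.const_smul c, fun ε hε => ?_⟩
  obtain ⟨A, hA, h1⟩ := hf.2 (ε / (‖c‖ + 1)) (by positivity)
  refine ⟨A, hA, fun y hy => ?_⟩
  rw [Pi.smul_apply, norm_smul]
  calc _ ≤ (‖c‖ + 1) * ‖f y‖ := by gcongr; linarith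
    _ < (‖c‖ + 1) * (ε / (‖c‖ + 1)) := by gcongr; exact h1 y hy
    _ = ε := by field_simp

theorem continuous_of_forall_approx {f : Y → E}
    (h : ∀ ε : ℝ, 0 < ε → ∃ g : Y → E, Continuous g ∧ ∀ y, ‖f y - g y‖ < ε) : Continuous f := by
  refine continuous_of_uniform_approx_of_continuous fun u hu => ?_
  obtain ⟨ε, hε, hu⟩ := Metric.mem_uniformity_dist.1 hu
  obtain ⟨g, hg, hfg⟩ := h ε hε
  exact ⟨g, hg, fun y => hu (by rw [dist_eq_norm]; exact hfg y)⟩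

theorem isCZero_of_forall_approx {f : Y → E}
    (h : ∀ ε : ℝ, 0 < ε → ∃ g : Y → E, IsCZero g ∧ ∀ y, ‖f y - g y‖ < ε) : IsCZero f := by
  refine ⟨continuous_of_forall_approx fun ε hε => ?_, fun ε hε => ?_⟩
  · obtain ⟨g, hg, hfg⟩ := h ε hε
    exact ⟨g, hg.1, hfg⟩
  · obtain ⟨g, hg, hfg⟩ := h (ε / 2) (by positivity)
    obtain ⟨A, hA, h1⟩ := hg.2 (ε / 2) (by positivity)
    refine ⟨A, hA, fun y hy => ?_⟩
    calc ‖f y‖ = ‖(f y - g y) + g y‖ := by rw [sub_add_cancel]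
      _ ≤ ‖f y - g y‖ + ‖g y‖ := norm_add_le _ _
      _ < ε / 2 + ε / 2 := add_lt_add (hfg y) (h1 y hy)
      _ = ε := add_halves ε

end CZero

/-! ### Radial operator valued kernels -/

section Radial

variable {H : Type*} [NormedAddCommGroup H] [InnerProductSpace ℂ H]
  {F : ℝ≥0 → H →L[ℂ] H}

theorem UltraweaklyContinuous.continuous_inner (hF : UltraweaklyContinuous F) (u v : H) :
    Continuous fun t => inner ℂ v (F t u) := by
  have hs : ∀ w : H, Summable fun n : ℕ => ‖(Pi.single 0 w : ℕ → H) n‖ ^ 2 := fun w =>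
    summable_of_ne_finset_zero (s := {0}) fun n hn => by
      rw [Pi.single_eq_of_ne (by simpa using hn)]; simp
  have h := hF (Pi.single 0 u) (Pi.single 0 v) (hs u) (hs v)
  refine h.congr fun t => ?_
  rw [tsum_eq_single 0 fun n hn => by rw [Pi.single_eq_of_ne hn, inner_zero_left]]
  simp

theorem scalarProjection_nonneg
    (hpd : ∀ v, IsPDRadial fun r => scalarProjection F v (NNReal.sqrt r))
    (t : ℝ≥0) (v : H) : 0 ≤ inner ℂ v (F t v) := by
  have := (hpd v).nonneg (t ^ 2)
  rwa [NNReal.sqrt_sq] at this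

/-- For a constant projection the quadratic form vanishes at two distinct points with the
vectors `v` and `-v`. -/
theorem IsStrictlyPDKernel.scalarProjection_not_const {m : ℕ} (hm : 1 ≤ m)
    (h : IsStrictlyPDKernel (radialKernel F m)) {v : H} (hv : v ≠ 0) :
    ¬ ∃ c : ℂ, ∀ t, scalarProjection F v t = c := by
  rintro ⟨c, hc⟩
  have hx : (EuclideanSpace.single (⟨0, hm⟩ : Fin m) (1 : ℝ)) ≠ 0 := by simp
  have := h.2 2 ![0, EuclideanSpace.single (⟨0, hm⟩ : Fin m) (1 : ℝ)] ![v, -v] (by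
    intro a b; fin_cases a <;> fin_cases b <;> simp [hx, hx.symm]) (by
    simp only [scalarProjection] at hc
    simp [Fin.sum_univ_two, radialKernel, hc]) 0
  exact hv (by simpa using this)

theorem IsStrictlyPDKernel.exists_scalarProjection_ne_zero {m : ℕ}
    (h : IsStrictlyPDKernel (radialKernel F m)) {v : H} (hv : v ≠ 0) :
    ∃ t, scalarProjection F v t ≠ 0 := by
  by_contra! hc
  have := h.2 1 (fun _ => 0) (fun _ => v) (Function.injective_of_subsingleton _) (by
    simp only [scalarProjection] at hc
    simp [radialKernel, hc]) 0
  exact hv this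

variable [CompleteSpace H]

/-- As `F` is monotone in the order of operators, the modulus of continuity of `F t v` is controlled
by that of its quadratic form. -/
theorem norm_sub_apply_sq_le
    (hpd : ∀ v, IsPDRadial fun r => scalarProjection F v (NNReal.sqrt r)) {B : ℝ}
    (hB : ∀ t, ‖F t‖ ≤ B) (s t : ℝ≥0) (v : H) :
    ‖F s v - F t v‖ ^ 2 ≤ 2 * B * |(inner ℂ v (F s v)).re - (inner ℂ v (F t v)).re| := by
  wlog hst : s ≤ t generalizing s t
  · have := this t s (le_of_not_ge hst)
    rwa [norm_sub_rev, abs_sub_comm] at this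
  have hpos : ∀ u, 0 ≤ inner ℂ u ((F s - F t) u) := by
    intro u
    have := (hpd u).antitone (show s ^ 2 ≤ t ^ 2 by gcongr)
    simp only [NNReal.sqrt_sq, scalarProjection] at this
    rw [sub_apply, inner_sub_right]
    exact sub_nonneg.2 this
  have h := norm_apply_sq_le_of_nonneg hpos v
  rw [sub_apply, inner_sub_right, Complex.sub_re] at h
  have hn : ‖F s - F t‖ ≤ 2 * B := (norm_sub_le _ _).trans (by linarith [hB s, hB t])
  have hB0 : 0 ≤ B := (norm_nonneg _).trans (hB 0)
  refine h.trans ?_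
  calc _ ≤ ‖F s - F t‖ * |(inner ℂ v (F s v)).re - (inner ℂ v (F t v)).re| := by
        gcongr; exact le_abs_self _
    _ ≤ _ := by gcongr

theorem continuous_apply_of_isPDRadial
    (hpd : ∀ v, IsPDRadial fun r => scalarProjection F v (NNReal.sqrt r)) {B : ℝ}
    (hB : ∀ t, ‖F t‖ ≤ B) {v : H} (hv : Continuous fun t => inner ℂ v (F t v)) :
    Continuous fun t => F t v := by
  refine continuous_iff_continuousAt.2 fun s => ?_
  rw [ContinuousAt, tendsto_iff_norm_sub_tendsto_zero]
  have h1 : Tendsto (fun t => 2 * B * |(inner ℂ v (F t v)).re - (inner ℂ v (F s v)).re|) (𝓝 s)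
      (𝓝 0) := by
    have hc : Continuous fun t => 2 * B * |(inner ℂ v (F t v)).re - (inner ℂ v (F s v)).re| :=
      continuous_const.mul (((Complex.continuous_re.comp hv).sub continuous_const).abs)
    simpa using hc.tendsto s
  have h2 := squeeze_zero (fun t => by positivity)
    (fun t => norm_sub_apply_sq_le hpd hB t s v) h1
  simpa using h2.sqrt

theorem rkhsFunctions_continuous {m : ℕ} (hK : IsPDKernel (radialKernel F m))
    (hc : ∀ v, Continuous fun t => F t v) : ∀ f ∈ rkhsFunctions hK, Continuous f := by
  refine rkhsFunctions_induction hK (C := ‖F 0‖) (fun x => by simp [radialKernel]) ?_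
    continuous_zero (fun f g hf hg => hf.add hg) (fun c f hf => hf.const_smul c)
    fun f hf => continuous_of_forall_approx hf
  intro y v
  exact (hc v).comp (continuous_id.sub continuous_const).nnnorm

theorem rkhsFunctions_isCZero_iff {m : ℕ} (hm : 1 ≤ m) (hK : IsPDKernel (radialKernel F m))
    (hpd : ∀ v, IsPDRadial fun r => scalarProjection F v (NNReal.sqrt r)) {B : ℝ}
    (hB : ∀ t, ‖F t‖ ≤ B) (hcs : ∀ v, Continuous (scalarProjection F v)) :
    (∀ f ∈ rkhsFunctions hK, IsCZero f) ↔ ∀ v : H, v ≠ 0 → IsCZero (scalarProjection F v) := by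
  constructor
  · intro h v _
    refine ⟨hcs v, fun ε hε => ?_⟩
    obtain ⟨A, hA, hAε⟩ := (h _ (kernel_section_mem_rkhsFunctions hK 0 v)).2 (ε / (‖v‖ + 1))
      (by positivity)
    refine ⟨(fun x => ‖x‖₊) '' A, hA.image continuous_nnnorm, fun t ht => ?_⟩
    have hx : ‖EuclideanSpace.single (⟨0, hm⟩ : Fin m) (t : ℝ)‖₊ = t := by
      simp [EuclideanSpace.single]
    have := hAε (EuclideanSpace.single (⟨0, hm⟩ : Fin m) (t : ℝ)) fun hmem => ht ⟨_, hmem, hx⟩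
    simp only [radialKernel, sub_zero, hx] at this
    calc ‖scalarProjection F v t‖ ≤ ‖v‖ * ‖F t v‖ := norm_inner_le_norm _ _
      _ ≤ (‖v‖ + 1) * ‖F t v‖ := by gcongr; linarith
      _ < (‖v‖ + 1) * (ε / (‖v‖ + 1)) := by gcongr
      _ = ε := by field_simp
  · intro h
    refine rkhsFunctions_induction hK (C := ‖F 0‖) (fun x => by simp [radialKernel]) ?_
      isCZero_zero (fun f g hf hg => hf.add hg) (fun c f hf => hf.smul c)
      fun f hf => isCZero_of_forall_approx hf
    intro y v
    refine ⟨(continuous_apply_of_isPDRadial hpd hB (hcs v)).comp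
      (continuous_id.sub continuous_const).nnnorm, fun ε hε => ?_⟩
    rcases eq_or_ne v 0 with rfl | hv
    · exact ⟨∅, isCompact_empty, fun x _ => by simpa using hε⟩
    have hB0 : 0 ≤ B := (norm_nonneg _).trans (hB 0)
    obtain ⟨A, hA, hAε⟩ := (h v hv).2 (ε ^ 2 / (B + 1)) (by positivity)
    obtain ⟨R, hR⟩ := hA.isBounded.subset_closedBall 0
    refine ⟨Metric.closedBall y R, isCompact_closedBall y R, fun x hx => ?_⟩
    have h1 := hAε ‖x - y‖₊ fun hmem => hx (by
      have := hR hmem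
      rw [Metric.mem_closedBall, dist_eq_norm]
      simpa [NNReal.dist_eq] using this)
    have h2 := norm_apply_sq_le_of_nonneg (fun u => scalarProjection_nonneg hpd ‖x - y‖₊ u) v
    refine lt_of_pow_lt_pow_left₀ 2 hε.le (h2.trans_lt ?_)
    calc _ ≤ (B + 1) * ‖scalarProjection F v ‖x - y‖₊‖ :=
          mul_le_mul ((hB _).trans (by linarith)) (Complex.re_le_norm _)
            (Complex.nonneg_iff.1 (scalarProjection_nonneg hpd _ v)).1 (by positivity)
      _ < (B + 1) * (ε ^ 2 / (B + 1)) := by gcongr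
      _ = ε ^ 2 := by field_simp

theorem not_const_of_isCZero {f : ℝ≥0 → ℂ} (hf : IsCZero f) (h : ∃ t, f t ≠ 0) :
    ¬ ∃ c : ℂ, ∀ t, f t = c := by
  rintro ⟨c, hc⟩
  obtain ⟨t, ht⟩ := h
  rw [hc] at ht
  obtain ⟨A, hA, hAε⟩ := hf.2 ‖c‖ (norm_pos_iff.2 ht)
  obtain ⟨R, hR⟩ := hA.isBounded.subset_closedBall 0
  have hs : R.toNNReal + 1 ∉ A := fun hmem => by
    have := hR hmem
    simp [NNReal.dist_eq] at this
    rw [abs_of_nonneg (by positivity)] at this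
    linarith [le_max_left R 0]
  have := hAε _ hs
  rw [hc] at this
  exact lt_irrefl _ this

end Radial

/-! ### The Fourier symbol of the Gaussians -/

/-- With `x = exp(-w)` and `s = π² |ξ|²` this is `(π / w) ^ (d / 2) exp(-s / w)`, the Fourier
transform at `ξ` of the Gaussian `exp(-w |·|²)` on a space of dimension `d`. By the conventions
`log 0 = 0` and `1 / 0 = 0` the formula gives at `x = 0` and `x = 1` the limit `0`. -/
noncomputable def gaussSymbolFun (d : ℕ) (s : ℝ) (x : I) : ℝ :=
  (Real.pi * (-Real.log x)⁻¹) ^ ((d : ℝ) / 2) * Real.exp (-s * (-Real.log x)⁻¹)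

theorem neg_log_inv_nonneg (x : I) : 0 ≤ (-Real.log (x : ℝ))⁻¹ :=
  inv_nonneg.2 (neg_nonneg.2 (Real.log_nonpos x.2.1 x.2.2))

theorem gaussSymbolFun_nonneg (d : ℕ) (s : ℝ) (x : I) : 0 ≤ gaussSymbolFun d s x := by
  have := neg_log_inv_nonneg x
  unfold gaussSymbolFun
  positivity

theorem gaussSymbolFun_pos {d : ℕ} {s : ℝ} {x : I} (h0 : (x : ℝ) ≠ 0) (h1 : (x : ℝ) ≠ 1) :
    0 < gaussSymbolFun d s x := by
  have h : 0 < (-Real.log (x : ℝ))⁻¹ := inv_pos.2 (neg_pos.2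
    (Real.log_neg (lt_of_le_of_ne x.2.1 h0.symm) (lt_of_le_of_ne x.2.2 h1)))
  unfold gaussSymbolFun
  positivity

theorem gaussSymbolFun_eq_zero {d : ℕ} (hd : 0 < d) {s : ℝ} {x : I} (h : Real.log (x : ℝ) = 0) :
    gaussSymbolFun d s x = 0 := by
  have : (d : ℝ) / 2 ≠ 0 := by positivity
  simp [gaussSymbolFun, h, Real.zero_rpow this]

theorem gaussSymbolFun_anti (d : ℕ) {s t : ℝ} (hst : s ≤ t) (x : I) :
    gaussSymbolFun d t x ≤ gaussSymbolFun d s x := by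
  have := neg_log_inv_nonneg x
  unfold gaussSymbolFun
  gcongr

theorem tendsto_gaussSymbolFun_one {d : ℕ} {s : ℝ} (hs : 0 < s) :
    Tendsto (gaussSymbolFun d s) (𝓝[≠] 1) (𝓝 0) := by
  have h1 : Tendsto (fun x : I => -Real.log (x : ℝ)) (𝓝[≠] 1) (𝓝[>] 0) := by
    refine tendsto_nhdsWithin_iff.2 ⟨?_, ?_⟩
    · have : ContinuousAt (fun x : I => -Real.log (x : ℝ)) 1 :=
        ((Real.continuousAt_log (by simp)).comp continuous_subtype_val.continuousAt).neg
      have h := this.tendsto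
      simp only [Set.Icc.coe_one, Real.log_one, neg_zero] at h
      exact h.mono_left nhdsWithin_le_nhds
    · have hpos : ∀ᶠ x : I in 𝓝[≠] 1, 0 < (x : ℝ) := by
        refine nhdsWithin_le_nhds (continuous_subtype_val.continuousAt.eventually_mem ?_)
        exact Ioi_mem_nhds (by simp)
      filter_upwards [hpos, self_mem_nhdsWithin] with x hx hx1
      exact neg_pos.2 (Real.log_neg hx (lt_of_le_of_ne x.2.2 fun h => hx1 (Subtype.ext h)))
  have h2 : Tendsto (fun z : ℝ => (Real.pi * z) ^ ((d : ℝ) / 2) * Real.exp (-s * z)) atTop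
      (𝓝 0) := by
    have h := (tendsto_rpow_mul_exp_neg_mul_atTop_nhds_zero ((d : ℝ) / 2) s hs).const_mul
      (Real.pi ^ ((d : ℝ) / 2))
    rw [mul_zero] at h
    refine h.congr' ?_
    filter_upwards [eventually_ge_atTop 0] with z hz
    rw [Real.mul_rpow Real.pi_pos.le hz, mul_assoc]
  exact h2.comp (tendsto_inv_nhdsGT_zero.comp h1)

theorem continuousAt_gaussSymbolFun {d : ℕ} (hd : 0 < d) {s : ℝ} (hs : 0 < s) (x : I) :
    ContinuousAt (fun p : ℝ × I => gaussSymbolFun d p.1 p.2) (s, x) := by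
  by_cases hx : (x : ℝ) = 1
  · obtain rfl : x = 1 := Subtype.ext hx
    have hz : gaussSymbolFun d (s / 2) 1 = 0 := gaussSymbolFun_eq_zero hd (by simp)
    have hz' : gaussSymbolFun d s 1 = 0 := gaussSymbolFun_eq_zero hd (by simp)
    have hc : ContinuousAt (gaussSymbolFun d (s / 2)) 1 := by
      rw [continuousAt_iff_punctured_nhds, hz]
      exact tendsto_gaussSymbolFun_one (half_pos hs)
    have hlim : Tendsto (fun p : ℝ × I => gaussSymbolFun d (s / 2) p.2) (𝓝 (s, 1)) (𝓝 0) := by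
      rw [← hz]
      exact hc.tendsto.comp (continuous_snd.tendsto (s, (1 : I)))
    rw [ContinuousAt, hz']
    refine squeeze_zero' (Eventually.of_forall fun p => gaussSymbolFun_nonneg d _ _) ?_ hlim
    have : ∀ᶠ p : ℝ × I in 𝓝 (s, 1), s / 2 < p.1 :=
      continuous_fst.continuousAt.eventually_mem (Ioi_mem_nhds (half_lt_self hs))
    filter_upwards [this] with p hp using gaussSymbolFun_anti d hp.le _
  · have hz : ContinuousAt (fun y : ℝ => (-Real.log y)⁻¹) x := by
      by_cases h0 : (x : ℝ) = 0
      · rw [h0, continuousAt_iff_punctured_nhds]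
        simp only [Real.log_zero, neg_zero, inv_zero]
        exact tendsto_inv_atTop_zero.comp
          (tendsto_neg_atBot_atTop.comp Real.tendsto_log_nhdsNE_zero)
      · refine ((Real.continuousAt_log h0).neg).inv₀ ?_
        exact neg_ne_zero.2 (Real.log_ne_zero_of_pos_of_ne_one
          (lt_of_le_of_ne x.2.1 (Ne.symm h0)) hx)
    have hz2 : ContinuousAt (fun p : ℝ × I => (-Real.log (p.2 : ℝ))⁻¹) (s, x) :=
      ContinuousAt.comp (f := fun p : ℝ × I => (p.2 : ℝ)) (x := (s, x)) hz (by fun_prop)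
    exact ((continuousAt_const.mul hz2).rpow_const (Or.inr (by positivity))).mul
      (Real.continuous_exp.continuousAt.comp (continuousAt_fst.neg.mul hz2))

theorem continuous_ofReal_gaussSymbolFun {d : ℕ} (hd : 0 < d) {s : ℝ} (hs : 0 < s) :
    Continuous fun x : I => (gaussSymbolFun d s x : ℂ) := by
  refine Complex.continuous_ofReal.comp (continuous_iff_continuousAt.2 fun x => ?_)
  exact (continuousAt_gaussSymbolFun hd hs x).comp (f := fun x : I => (s, x)) (by fun_prop)

open Classical in
/-- The symbol `gaussSymbolFun d s` as a continuous function on the unit interval; it is only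
continuous, and only used, for `s > 0` and `d > 0`. -/
noncomputable def gaussSymbol (d : ℕ) (s : ℝ) : C(I, ℂ) :=
  if h : 0 < d ∧ 0 < s then ⟨_, continuous_ofReal_gaussSymbolFun h.1 h.2⟩ else 0

theorem gaussSymbol_apply {d : ℕ} (hd : 0 < d) {s : ℝ} (hs : 0 < s) (x : I) :
    gaussSymbol d s x = gaussSymbolFun d s x := by
  rw [gaussSymbol, dif_pos ⟨hd, hs⟩]; rfl

theorem continuousOn_gaussSymbol {d : ℕ} (hd : 0 < d) :
    ContinuousOn (gaussSymbol d) (Set.Ioi 0) := by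
  rw [continuousOn_iff_continuous_domRestrict]
  have h : Continuous fun p : Set.Ioi (0 : ℝ) × I => (gaussSymbolFun d p.1 p.2 : ℂ) := by
    refine Complex.continuous_ofReal.comp (continuous_iff_continuousAt.2 fun p => ?_)
    exact (continuousAt_gaussSymbolFun hd p.1.2 p.2).comp
      (f := fun p : Set.Ioi (0 : ℝ) × I => ((p.1 : ℝ), p.2)) (by fun_prop)
  have h2 := (ContinuousMap.curry ⟨_, h⟩).continuous
  refine h2.congr fun s => ?_
  ext x
  exact (gaussSymbol_apply hd s.2 x).symm

/-! ### Superpositions of translated Gaussians -/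

section Fourier

open scoped FourierTransform SchwartzMap RealInnerProductSpace

theorem continuousOn_gaussSymbol_norm {V : Type*} [NormedAddCommGroup V] [InnerProductSpace ℝ V]
    [FiniteDimensional ℝ V] [Nontrivial V] :
    ContinuousOn (fun ξ : V => gaussSymbol (Module.finrank ℝ V) (Real.pi ^ 2 * ‖ξ‖ ^ 2)) {0}ᶜ := by
  refine (continuousOn_gaussSymbol Module.finrank_pos).comp (by fun_prop) fun ξ hξ => ?_
  have : 0 < ‖ξ‖ := norm_pos_iff.2 hξ
  have := Real.pi_pos
  rw [Set.mem_Ioi]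
  positivity

theorem continuous_smul_of_notMem_tsupport {V E : Type*} [NormedAddCommGroup V]
    [NormedAddCommGroup E] [NormedSpace ℂ E]
    {φ : V → ℂ} (hφ : Continuous φ) (h0 : (0 : V) ∉ tsupport φ) {f : V → E}
    (hf : ContinuousOn f {0}ᶜ) : Continuous fun ξ => φ ξ • f ξ := by
  refine continuous_of_tsupport fun ξ hξ => ?_
  have hξ0 : ξ ≠ 0 := fun h => h0 (h ▸ tsupport_smul_subset_left φ f hξ)
  exact hφ.continuousAt.smul (hf.continuousAt (isOpen_compl_singleton.mem_nhds hξ0))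

variable {V : Type*} [NormedAddCommGroup V] [InnerProductSpace ℝ V] [FiniteDimensional ℝ V]
  [MeasurableSpace V] [BorelSpace V]

theorem integral_fourierInv_mul_gaussian (φ : 𝓢(V, ℂ)) {w : ℝ} (hw : 0 < w) (x : V) :
    ∫ y, (𝓕⁻ φ : 𝓢(V, ℂ)) y * ((Real.exp (-w * ‖x - y‖ ^ 2) : ℝ) : ℂ) =
      ∫ ξ, φ ξ * (Real.fourierChar ⟪ξ, x⟫ : ℂ) *
        (((Real.pi * w⁻¹) ^ ((Module.finrank ℝ V : ℝ) / 2) *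
        Real.exp (-(Real.pi ^ 2 * ‖ξ‖ ^ 2) * w⁻¹) : ℝ) : ℂ) := by
  set d : ℝ := ((Module.finrank ℝ V : ℕ) : ℝ)
  set b : ℝ := Real.pi ^ 2 / w with hb
  have hπ := Real.pi_pos
  have hb0 : 0 < b := by positivity
  have hb' : 0 < (b : ℂ).re := by simpa using hb0
  set g : V → ℂ := fun v => Complex.exp (-b * ‖v‖ ^ 2 + 2 * Real.pi * Complex.I * (⟪x, v⟫ : ℝ))
  have hg : Integrable g := GaussianFourier.integrable_cexp_neg_mul_sq_norm_add hb' _ x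
  set p : 𝓢(V, ℂ) := 𝓕⁻ φ with hp
  have hφ : (φ : V → ℂ) = 𝓕 (p : V → ℂ) := by
    rw [← SchwartzMap.fourier_coe, hp, FourierTransform.fourier_fourierInv_eq]
  have e1 : ∀ y, 𝓕 g y = (((Real.pi / b) ^ (d / 2) : ℝ) : ℂ) *
      ((Real.exp (-w * ‖x - y‖ ^ 2) : ℝ) : ℂ) := by
    intro y
    rw [fourier_gaussian_innerProductSpace' hb', Complex.ofReal_cpow (by positivity)]
    push_cast
    congr 2
    rw [hb]
    push_cast
    have : (Real.pi : ℂ) ≠ 0 := by exact_mod_cast hπ.ne'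
    field_simp
  have key : ∫ ξ, 𝓕 (p : V → ℂ) ξ • g ξ = ∫ y, p y • 𝓕 g y := by
    have := VectorFourier.integral_fourierIntegral_smul_eq_flip (L := innerₗ V)
      (μ := volume) (ν := volume) Real.continuous_fourierChar continuous_inner p.integrable hg
    rw [flip_innerₗ] at this
    exact this
  have hC : (Real.pi * w⁻¹) ^ (d / 2) * (Real.pi / b) ^ (d / 2) = 1 := by
    rw [← Real.mul_rpow (by positivity) (by positivity), hb]
    have : Real.pi * w⁻¹ * (Real.pi / (Real.pi ^ 2 / w)) = 1 := by field_simp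
    rw [this, Real.one_rpow]
  have hC' : ((((Real.pi * w⁻¹) ^ (d / 2) : ℝ) : ℂ)) * (((Real.pi / b) ^ (d / 2) : ℝ) : ℂ) = 1 := by
    exact_mod_cast hC
  calc ∫ y, p y * ((Real.exp (-w * ‖x - y‖ ^ 2) : ℝ) : ℂ)
      = ∫ y, (((Real.pi * w⁻¹) ^ (d / 2) : ℝ) : ℂ) * (p y • 𝓕 g y) := by
        refine integral_congr_ae (Eventually.of_forall fun y => ?_)
        simp only [e1, smul_eq_mul]
        linear_combination (-(p y * ((Real.exp (-w * ‖x - y‖ ^ 2) : ℝ) : ℂ))) * hC'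
    _ = ∫ ξ, (((Real.pi * w⁻¹) ^ (d / 2) : ℝ) : ℂ) * (𝓕 (p : V → ℂ) ξ • g ξ) := by
        rw [integral_const_mul, integral_const_mul, key]
    _ = _ := by
        refine integral_congr_ae (Eventually.of_forall fun ξ => ?_)
        simp only [← hφ, smul_eq_mul, g, Real.fourierChar_apply, Complex.ofReal_mul]
        rw [Complex.exp_add, real_inner_comm x ξ, Complex.ofReal_exp, hb]
        push_cast
        ring_nf

variable [Nontrivial V]

theorem integrable_smul_rpowI {p : V → ℂ} (hp : Integrable p) (x : V) :
    Integrable fun y => p y • rpowI (‖x - y‖₊ ^ 2) := by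
  have hb : ∀ r, ‖rpowI r‖ ≤ 1 := fun r => by
    refine (ContinuousMap.norm_le _ zero_le_one).2 fun t => ?_
    rw [rpowI_apply, Complex.norm_real, Real.norm_of_nonneg (Real.rpow_nonneg t.2.1 _)]
    exact Real.rpow_le_one t.2.1 t.2.2 r.2
  have hm : AEStronglyMeasurable (fun y => rpowI (‖x - y‖₊ ^ 2)) (volume : Measure V) := by
    have hc : ContinuousOn (fun y => rpowI (‖x - y‖₊ ^ 2)) {x}ᶜ := by
      refine continuousOn_rpowI.comp (by fun_prop) fun y hy => ?_
      have : x - y ≠ 0 := sub_ne_zero.2 (Ne.symm hy)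
      exact pow_pos (nnnorm_pos.2 this) 2
    have h := hc.aestronglyMeasurable (μ := volume) (measurableSet_singleton x).compl
    rwa [Measure.restrict_eq_self_of_ae_mem] at h
    exact (Set.countable_singleton x).ae_notMem volume
  refine Integrable.mono hp (hp.aestronglyMeasurable.smul hm) (Eventually.of_forall fun y => ?_)
  rw [norm_smul]
  exact mul_le_of_le_one_right (norm_nonneg _) (hb _)

theorem integrable_smul_gaussSymbol {φ : V → ℂ} (hφ : Continuous φ) (hc : HasCompactSupport φ)
    (h0 : (0 : V) ∉ tsupport φ) (x : V) :
    Integrable fun ξ => (φ ξ * (Real.fourierChar ⟪ξ, x⟫ : ℂ)) •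
      gaussSymbol (Module.finrank ℝ V) (Real.pi ^ 2 * ‖ξ‖ ^ 2) := by
  set f : V → C(I, ℂ) := fun ξ => (Real.fourierChar ⟪ξ, x⟫ : ℂ) •
    gaussSymbol (Module.finrank ℝ V) (Real.pi ^ 2 * ‖ξ‖ ^ 2)
  have hf : ContinuousOn f {0}ᶜ := by
    have h1 : Continuous fun ξ : V => (Real.fourierChar ⟪ξ, x⟫ : ℂ) :=
      continuous_subtype_val.comp (Real.continuous_fourierChar.comp (by fun_prop))
    exact h1.continuousOn.smul continuousOn_gaussSymbol_norm
  have h : Integrable fun ξ => φ ξ • f ξ :=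
    (continuous_smul_of_notMem_tsupport hφ h0 hf).integrable_of_hasCompactSupport
      (HasCompactSupport.smul_right (f := φ) (f' := f) hc)
  simpa only [f, ← mul_smul] using h

/-- A superposition of translates of the Gaussians, written on the Fourier side; an identity
between integrals with values in the continuous functions on the unit interval. The hypothesis
that `φ` vanishes near the origin makes the two sides agree at the end point `x = 1`, where the
Gaussian degenerates to a constant. -/
theorem integral_fourierInv_smul_rpowI {φ : 𝓢(V, ℂ)} (hc : HasCompactSupport φ)
    (h0 : (0 : V) ∉ tsupport φ) (x : V) :
    ∫ y, (𝓕⁻ φ : 𝓢(V, ℂ)) y • rpowI (‖x - y‖₊ ^ 2) =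
      ∫ ξ, (φ ξ * (Real.fourierChar ⟪ξ, x⟫ : ℂ)) •
        gaussSymbol (Module.finrank ℝ V) (Real.pi ^ 2 * ‖ξ‖ ^ 2) := by
  have hd : 0 < Module.finrank ℝ V := Module.finrank_pos
  have hφ0 : φ 0 = 0 := image_eq_zero_of_notMem_tsupport h0
  ext t
  have hL := (ContinuousMap.evalCLM ℂ t).integral_comp_comm
    (integrable_smul_rpowI (𝓕⁻ φ : 𝓢(V, ℂ)).integrable x)
  have hR := (ContinuousMap.evalCLM ℂ t).integral_comp_comm
    (integrable_smul_gaussSymbol φ.continuous hc h0 x)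
  simp only [ContinuousMap.evalCLM_apply, ContinuousMap.smul_apply, smul_eq_mul] at hL hR
  rw [← hL, ← hR]
  have hsymb : ∀ ξ : V, φ ξ * (Real.fourierChar ⟪ξ, x⟫ : ℂ) *
      gaussSymbol (Module.finrank ℝ V) (Real.pi ^ 2 * ‖ξ‖ ^ 2) t =
      φ ξ * (Real.fourierChar ⟪ξ, x⟫ : ℂ) *
      (gaussSymbolFun (Module.finrank ℝ V) (Real.pi ^ 2 * ‖ξ‖ ^ 2) t : ℂ) := by
    intro ξ
    rcases eq_or_ne ξ 0 with rfl | hξ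
    · rw [hφ0]; simp
    · have := Real.pi_pos
      have := norm_pos_iff.2 hξ
      rw [gaussSymbol_apply hd (by positivity)]
  simp only [hsymb]
  rcases eq_or_lt_of_le t.2.1 with ht0 | ht0
  · have h1 : ∀ ξ : V, gaussSymbolFun (Module.finrank ℝ V) (Real.pi ^ 2 * ‖ξ‖ ^ 2) t = 0 := fun ξ =>
      gaussSymbolFun_eq_zero hd (by rw [← ht0, Real.log_zero])
    simp only [h1, Complex.ofReal_zero, mul_zero, integral_zero]
    refine integral_eq_zero_of_ae ?_
    filter_upwards [(Set.countable_singleton x).ae_notMem volume] with y hy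
    have hy' : x - y ≠ 0 := sub_ne_zero.2 (Ne.symm hy)
    rw [rpowI_apply, ← ht0, Real.zero_rpow (by simpa using hy')]
    simp
  rcases eq_or_lt_of_le t.2.2 with ht1 | ht1
  · have h1 : ∀ ξ : V, gaussSymbolFun (Module.finrank ℝ V) (Real.pi ^ 2 * ‖ξ‖ ^ 2) t = 0 := fun ξ =>
      gaussSymbolFun_eq_zero hd (by rw [ht1, Real.log_one])
    simp only [h1, Complex.ofReal_zero, mul_zero, integral_zero, rpowI_apply, ht1, Real.one_rpow,
      Complex.ofReal_one, mul_one]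
    have h2 : 𝓕 ((𝓕⁻ φ : 𝓢(V, ℂ)) : V → ℂ) 0 = φ 0 := by
      rw [← SchwartzMap.fourier_coe, FourierTransform.fourier_fourierInv_eq]
    rw [Real.fourier_eq] at h2
    simpa [hφ0] using h2
  · have hw : 0 < -Real.log t := neg_pos.2 (Real.log_neg ht0 ht1)
    have h := integral_fourierInv_mul_gaussian φ hw x
    have e : ∀ y, rpowI (‖x - y‖₊ ^ 2) t =
        ((Real.exp (-(-Real.log t) * ‖x - y‖ ^ 2) : ℝ) : ℂ) := by
      intro y
      rw [rpowI_apply, Real.rpow_def_of_pos ht0, neg_neg]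
      simp
    simp only [e]
    exact h

end Fourier

/-! ### Density of the range of the Fourier symbol -/

section DenseRange

variable {H : Type*} [NormedAddCommGroup H] [InnerProductSpace ℂ H]

theorem IsCompletelyPositive.inner_nonneg {Λ : C(I, ℂ) →L[ℂ] H →L[ℂ] H}
    (hΛ : IsCompletelyPositive Λ) {g : C(I, ℂ)} (hg : ∀ x, 0 ≤ g x) (v : H) :
    0 ≤ inner ℂ v (Λ g v) := by
  have := hΛ (ι := Unit) (fun _ _ => g) (fun _ => v) fun x => by
    have e : (Matrix.of fun _ _ : Unit => g x) = Matrix.diagonal fun _ => g x := by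
      ext i j; simp
    rw [e]
    exact Matrix.PosSemidef.diagonal fun _ => hg x
  simpa using this

/-- A function vanishing on the zero set of `γ ≥ 0` is bounded by a multiple of `γ` up to a small
error; no rate of vanishing is needed. -/
theorem exists_abs_le_mul_add {Y : Type*} [TopologicalSpace Y] [CompactSpace Y] {f γ : Y → ℝ}
    (hf : Continuous f) (hγ : Continuous γ) (hγ0 : ∀ x, 0 ≤ γ x) (h : ∀ x, γ x = 0 → f x = 0)
    {ε : ℝ} (hε : 0 < ε) : ∃ C : ℝ, 0 ≤ C ∧ ∀ x, |f x| ≤ C * γ x + ε := by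
  have hcomp : IsCompact {x | ε ≤ |f x|} := (isClosed_le continuous_const hf.abs).isCompact
  rcases Set.eq_empty_or_nonempty {x | ε ≤ |f x|} with he | hne
  · refine ⟨0, le_rfl, fun x => ?_⟩
    have : x ∉ {x | ε ≤ |f x|} := by rw [he]; exact Set.notMem_empty x
    simpa using (not_le.1 this).le
  · obtain ⟨a, ha, hmin⟩ := hcomp.exists_isMinOn hne hγ.continuousOn
    obtain ⟨b, -, hmax⟩ := hcomp.exists_isMaxOn hne hf.abs.continuousOn
    have hγa : 0 < γ a := lt_of_le_of_ne (hγ0 a) fun h0 => by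
      have h1 : ε ≤ |f a| := ha
      rw [h a h0.symm, abs_zero] at h1
      exact absurd h1 (not_le.2 hε)
    refine ⟨|f b| / γ a, by positivity, fun x => ?_⟩
    by_cases hx : ε ≤ |f x|
    · have h1 : γ a ≤ γ x := hmin hx
      have h2 : |f x| ≤ |f b| := hmax hx
      calc |f x| ≤ |f b| / γ a * γ a := by rw [div_mul_cancel₀ _ hγa.ne']; exact h2
        _ ≤ |f b| / γ a * γ x := by gcongr
        _ ≤ _ := le_add_of_nonneg_right hε.le
    · exact (not_le.1 hx).le.trans (le_add_of_nonneg_left (mul_nonneg (by positivity) (hγ0 x)))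

/-- The Fourier symbol vanishes only at the end points `x = 0, 1`. A vector at which its quadratic
form vanishes therefore does not see the functions `x ^ r - x ^ s`, which vanish there too. -/
theorem IsCompletelyPositive.inner_rpowI_eq {Λ : C(I, ℂ) →L[ℂ] H →L[ℂ] H}
    (hΛ : IsCompletelyPositive Λ) {d : ℕ} (hd : 0 < d) {τ : ℝ} (hτ : 0 < τ) {v : H}
    (hv : inner ℂ v (Λ (gaussSymbol d τ) v) = 0) {r s : ℝ≥0} (hr : 0 < r) (hs : 0 < s) :
    inner ℂ v (Λ (rpowI r) v) = inner ℂ v (Λ (rpowI s) v) := by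
  have hnn : ∀ r, 0 ≤ inner ℂ v (Λ (rpowI r) v) := fun r => hΛ.inner_nonneg (fun x => by
    rw [rpowI_apply]; exact_mod_cast Real.rpow_nonneg x.2.1 _) v
  have hrr : (0 : ℝ) < r := hr
  have hss : (0 : ℝ) < s := hs
  have hcr : ∀ r : ℝ≥0, Continuous fun x : I => (x : ℝ) ^ (r : ℝ) := fun r =>
    (Real.continuous_rpow_const r.2).comp continuous_subtype_val
  have key : ∀ ε : ℝ, 0 < ε → |(inner ℂ v (Λ (rpowI r) v)).re - (inner ℂ v (Λ (rpowI s) v)).re| ≤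
      ε * (inner ℂ v (Λ (rpowI 0) v)).re := by
    intro ε hε
    obtain ⟨C, hC, hle⟩ := exists_abs_le_mul_add
      (f := fun x : I => (x : ℝ) ^ (r : ℝ) - (x : ℝ) ^ (s : ℝ)) (γ := gaussSymbolFun d τ)
      ((hcr r).sub (hcr s))
      (continuous_iff_continuousAt.2 fun x =>
        (continuousAt_gaussSymbolFun hd hτ x).comp (f := fun x : I => (τ, x)) (by fun_prop))
      (gaussSymbolFun_nonneg d τ) (fun x hx => by
        by_cases h0 : (x : ℝ) = 0
        · simp only [h0, Real.zero_rpow hrr.ne', Real.zero_rpow hss.ne', sub_zero]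
        by_cases h1 : (x : ℝ) = 1
        · simp only [h1, Real.one_rpow, sub_self]
        · exact absurd hx (gaussSymbolFun_pos h0 h1).ne') hε
    have hp : ∀ c : ℝ, |c| = 1 → 0 ≤ (ε * (inner ℂ v (Λ (rpowI 0) v)).re) +
        c * ((inner ℂ v (Λ (rpowI r) v)).re - (inner ℂ v (Λ (rpowI s) v)).re) := by
      intro c hc
      have h := hΛ.inner_nonneg (g := (C : ℂ) • gaussSymbol d τ + (ε : ℂ) • rpowI 0 +
        (c : ℂ) • (rpowI r - rpowI s)) (fun x => by
          have h1 : 0 ≤ C * gaussSymbolFun d τ x + ε +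
              c * ((x : ℝ) ^ (r : ℝ) - (x : ℝ) ^ (s : ℝ)) := by
            have h2 := hle x
            have h3 : |c * ((x : ℝ) ^ (r : ℝ) - (x : ℝ) ^ (s : ℝ))| ≤
                C * gaussSymbolFun d τ x + ε := by
              rw [abs_mul, hc, one_mul]; exact h2
            linarith [neg_abs_le (c * ((x : ℝ) ^ (r : ℝ) - (x : ℝ) ^ (s : ℝ)))]
          simp only [ContinuousMap.add_apply, ContinuousMap.smul_apply, ContinuousMap.sub_apply,
            gaussSymbol_apply hd hτ, rpowI_apply, smul_eq_mul, NNReal.coe_zero, Real.rpow_zero]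
          have h4 : (C : ℂ) * (gaussSymbolFun d τ x : ℂ) + (ε : ℂ) * ((1 : ℝ) : ℂ) +
              (c : ℂ) * ((((x : ℝ) ^ (r : ℝ) : ℝ) : ℂ) - (((x : ℝ) ^ (s : ℝ) : ℝ) : ℂ)) =
              ((C * gaussSymbolFun d τ x + ε +
                c * ((x : ℝ) ^ (r : ℝ) - (x : ℝ) ^ (s : ℝ)) : ℝ) : ℂ) := by
            push_cast; ring
          rw [h4]
          exact_mod_cast h1) v
      simp only [map_add, map_smul, map_sub, add_apply, smul_apply, sub_apply, inner_add_right,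
        inner_smul_right, inner_sub_right, hv, mul_zero, zero_add] at h
      have h' := (Complex.nonneg_iff.1 h).1
      simpa only [Complex.add_re, Complex.re_ofReal_mul, Complex.sub_re] using h'
    rw [abs_le]
    have h1 := hp 1 (by simp)
    have h2 := hp (-1) (by simp)
    constructor <;> linarith
  have h0 : |(inner ℂ v (Λ (rpowI r) v)).re - (inner ℂ v (Λ (rpowI s) v)).re| ≤ 0 := by
    have hlim : Tendsto (fun ε : ℝ => ε * (inner ℂ v (Λ (rpowI 0) v)).re) (𝓝[>] 0) (𝓝 0) := by
      have : Tendsto (fun ε : ℝ => ε * (inner ℂ v (Λ (rpowI 0) v)).re) (𝓝 0)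
        (𝓝 (0 * (inner ℂ v (Λ (rpowI 0) v)).re)) := tendsto_id.mul_const _
      rw [zero_mul] at this
      exact this.mono_left nhdsWithin_le_nhds
    refine ge_of_tendsto hlim ?_
    filter_upwards [self_mem_nhdsWithin] with ε hε using key ε hε
  have h1 := sub_eq_zero.1 (abs_nonpos_iff.1 h0)
  refine Complex.ext h1 ?_
  rw [← (Complex.nonneg_iff.1 (hnn r)).2, ← (Complex.nonneg_iff.1 (hnn s)).2]

/-- A vector orthogonal to the range is one at which the quadratic form of the positive operator
vanishes, and the projection of `F` at such a vector is constant. -/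
theorem denseRange_gaussSymbol [CompleteSpace H] {F : ℝ≥0 → H →L[ℂ] H}
    {Λ : C(I, ℂ) →L[ℂ] H →L[ℂ] H}
    (hΛ : IsCompletelyPositive Λ) (hΛF : ∀ t, Λ (rpowI (t ^ 2)) = F t)
    (hcs : ∀ v, Continuous (scalarProjection F v))
    (hnc : ∀ v : H, v ≠ 0 → ¬ ∃ c : ℂ, ∀ t, scalarProjection F v t = c)
    {d : ℕ} (hd : 0 < d) {τ : ℝ} (hτ : 0 < τ) : DenseRange (Λ (gaussSymbol d τ)) := by
  have hnn : ∀ v, 0 ≤ inner ℂ v (Λ (gaussSymbol d τ) v) := fun v => hΛ.inner_nonneg (fun x => by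
    rw [gaussSymbol_apply hd hτ]; exact_mod_cast gaussSymbolFun_nonneg d τ x) v
  have hbot : (LinearMap.range (Λ (gaussSymbol d τ)).toLinearMap)ᗮ = ⊥ := by
    refine (Submodule.eq_bot_iff _).2 fun v hv => ?_
    have h0 : inner ℂ v (Λ (gaussSymbol d τ) v) = 0 :=
      Submodule.inner_left_of_mem_orthogonal (LinearMap.mem_range_self _ v) hv
    by_contra hv0
    refine hnc v hv0 ⟨scalarProjection F v 1, fun t => ?_⟩
    have hpos : ∀ t : ℝ≥0, 0 < t → scalarProjection F v t = scalarProjection F v 1 := by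
      intro t ht
      rw [scalarProjection, scalarProjection, ← hΛF, ← hΛF]
      exact hΛ.inner_rpowI_eq hd hτ h0 (pow_pos ht 2) (by simp)
    -- The value at `0` corresponds to the constant function `1`, which the symbol does not control;
    -- it follows by continuity.
    rcases eq_or_ne t 0 with rfl | ht
    · have h1 : Tendsto (scalarProjection F v) (𝓝[>] 0) (𝓝 (scalarProjection F v 0)) :=
        ((hcs v).tendsto 0).mono_left nhdsWithin_le_nhds
      have h2 : Tendsto (scalarProjection F v) (𝓝[>] 0) (𝓝 (scalarProjection F v 1)) := by
        refine tendsto_const_nhds.congr' ?_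
        filter_upwards [self_mem_nhdsWithin] with s hs using (hpos s hs).symm
      exact tendsto_nhds_unique h1 h2
    · exact hpos t (pos_iff_ne_zero.2 ht)
  have htop := Submodule.topologicalClosure_eq_top_iff.2 hbot
  intro u
  have : u ∈ (LinearMap.range (Λ (gaussSymbol d τ)).toLinearMap).topologicalClosure := by
    rw [htop]; trivial
  simpa [← SetLike.mem_coe, Submodule.topologicalClosure_coe, LinearMap.coe_range] using this

end DenseRange

/-! ### Approximation by functions of the reproducing kernel Hilbert space -/

section Approximation

open scoped FourierTransform SchwartzMap RealInnerProductSpace Manifold ContDiff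

variable {H : Type*} [NormedAddCommGroup H] [InnerProductSpace ℂ H] [CompleteSpace H] {m : ℕ}

/-- The superposition of the sections `K(·, y) v` against the inverse Fourier transform of `φ`,
written on the Fourier side. -/
theorem integral_smul_gaussSymbol_mem_rkhsFunctions [Nontrivial (EuclideanSpace ℝ (Fin m))]
    {F : ℝ≥0 → H →L[ℂ] H} (hK : IsPDKernel (radialKernel F m))
    {Λ : C(I, ℂ) →L[ℂ] H →L[ℂ] H} (hΛF : ∀ t, Λ (rpowI (t ^ 2)) = F t)
    (hcs : ∀ v, Continuous (scalarProjection F v))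
    {φ : EuclideanSpace ℝ (Fin m) → ℂ} (hφ : ContDiff ℝ ∞ φ) (hc : HasCompactSupport φ)
    (h0 : 0 ∉ tsupport φ) (v : H) :
    (fun x => ∫ ξ, (φ ξ * (Real.fourierChar ⟪ξ, x⟫ : ℂ)) •
      Λ (gaussSymbol (Module.finrank ℝ (EuclideanSpace ℝ (Fin m))) (Real.pi ^ 2 * ‖ξ‖ ^ 2)) v) ∈
      rkhsFunctions hK := by
  set ψ : 𝓢(EuclideanSpace ℝ (Fin m), ℂ) := hc.toSchwartzMap hφ
  have hψ : (ψ : EuclideanSpace ℝ (Fin m) → ℂ) = φ := rfl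
  have h := integral_smul_kernel_mem_rkhsFunctions hK (μ := volume) (C := ‖F 0‖)
    (fun x => by simp [radialKernel]) (v := v)
    ((hcs v).comp (continuous_fst.sub continuous_snd).nnnorm)
    (𝓕⁻ ψ : 𝓢(EuclideanSpace ℝ (Fin m), ℂ)).integrable
  convert h using 1
  funext x
  let L : C(I, ℂ) →L[ℂ] H := (ContinuousLinearMap.apply ℂ H v).comp Λ
  have hL := L.integral_comp_comm
    (integrable_smul_rpowI (𝓕⁻ ψ : 𝓢(EuclideanSpace ℝ (Fin m), ℂ)).integrable x)
  have hR := L.integral_comp_comm (integrable_smul_gaussSymbol ψ.continuous hc h0 x)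
  rw [integral_fourierInv_smul_rpowI (φ := ψ) hc h0 x, ← hR] at hL
  simp only [map_smul] at hL
  refine Eq.trans ?_ (hL.symm.trans ?_)
  · rfl
  · refine integral_congr_ae (Eventually.of_forall fun y => ?_)
    simp only [L, ContinuousLinearMap.comp_apply, ContinuousLinearMap.apply_apply, hΛF,
      radialKernel]

/-- As the symbol has dense range at every frequency `ξ ≠ 0`, a partition of unity in frequency
space approximates the constant vector `u` by combinations of the values of the symbol. -/
theorem exists_rkhsFunctions_approx_fourierInv [Nontrivial (EuclideanSpace ℝ (Fin m))]
    {F : ℝ≥0 → H →L[ℂ] H} (hK : IsPDKernel (radialKernel F m))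
    {Λ : C(I, ℂ) →L[ℂ] H →L[ℂ] H} (hΛF : ∀ t, Λ (rpowI (t ^ 2)) = F t)
    (hcs : ∀ v, Continuous (scalarProjection F v))
    (hdense : ∀ τ : ℝ, 0 < τ →
      DenseRange (Λ (gaussSymbol (Module.finrank ℝ (EuclideanSpace ℝ (Fin m))) τ)))
    {h : EuclideanSpace ℝ (Fin m) → ℂ} (hh : ContDiff ℝ ∞ h) (hc : HasCompactSupport h)
    (h0 : 0 ∉ tsupport h) (u : H) {ε : ℝ} (hε : 0 < ε) :
    ∃ f ∈ rkhsFunctions hK, ∀ x,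
      ‖f x - (∫ ξ, h ξ * (Real.fourierChar ⟪ξ, x⟫ : ℂ)) • u‖ ≤ ε * ∫ ξ, ‖h ξ‖ := by
  set T : EuclideanSpace ℝ (Fin m) → H →L[ℂ] H := fun ξ =>
    Λ (gaussSymbol (Module.finrank ℝ (EuclideanSpace ℝ (Fin m))) (Real.pi ^ 2 * ‖ξ‖ ^ 2))
  have hTc : ContinuousOn T {0}ᶜ := Λ.continuous.comp_continuousOn continuousOn_gaussSymbol_norm
  have hloc : ∀ ξ₀ : tsupport h, ∃ v : H, ∃ U : Set (EuclideanSpace ℝ (Fin m)), IsOpen U ∧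
      (ξ₀ : EuclideanSpace ℝ (Fin m)) ∈ U ∧
      ∀ ξ ∈ U, ‖T ξ v - u‖ ≤ ε := by
    intro ξ₀
    have hξ₀ : (ξ₀ : EuclideanSpace ℝ (Fin m)) ≠ 0 := fun e => h0 (e ▸ ξ₀.2)
    have hpos : 0 < Real.pi ^ 2 * ‖(ξ₀ : EuclideanSpace ℝ (Fin m))‖ ^ 2 := by
      have := norm_pos_iff.2 hξ₀
      have := Real.pi_pos
      positivity
    obtain ⟨v, hv⟩ := (hdense _ hpos).exists_dist_lt u hε
    have hca : ContinuousAt (fun ξ => ‖T ξ v - u‖) (ξ₀ : EuclideanSpace ℝ (Fin m)) := by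
      have h1 := hTc.continuousAt (isOpen_compl_singleton.mem_nhds hξ₀)
      exact ((h1.clm_apply continuousAt_const).sub continuousAt_const).norm
    have hev : ∀ᶠ ξ in 𝓝 (ξ₀ : EuclideanSpace ℝ (Fin m)), ‖T ξ v - u‖ < ε := by
      refine hca.eventually_mem (Iio_mem_nhds ?_)
      rw [dist_comm, dist_eq_norm] at hv
      exact hv
    obtain ⟨U, hU, hUo, hmem⟩ := eventually_nhds_iff.1 hev
    exact ⟨v, U, hUo, hmem, fun ξ hξ => (hU ξ hξ).le⟩
  choose v U hUo hmem hU using hloc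
  obtain ⟨t, ht⟩ := hc.isCompact.elim_finite_subcover U hUo
    fun ξ hξ => Set.mem_iUnion.2 ⟨⟨ξ, hξ⟩, hmem ⟨ξ, hξ⟩⟩
  obtain ⟨ρ, hρ⟩ := SmoothPartitionOfUnity.exists_isSubordinate
    𝓘(ℝ, EuclideanSpace ℝ (Fin m)) (isClosed_tsupport h) (fun i : t => U i) (fun i => hUo i) (by
      intro ξ hξ
      obtain ⟨i, hi, hξi⟩ := Set.mem_iUnion₂.1 (ht hξ)
      exact Set.mem_iUnion.2 ⟨⟨i, hi⟩, hξi⟩)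
  let φ : t → EuclideanSpace ℝ (Fin m) → ℂ := fun i ξ => (ρ i ξ : ℂ) * h ξ
  have hφs : ∀ i, ContDiff ℝ ∞ (φ i) := fun i =>
    (Complex.ofRealCLM.contDiff.comp (ρ i).contMDiff.contDiff).mul hh
  have hφc : ∀ i, HasCompactSupport (φ i) := fun i => hc.mul_left
  have hφ0 : ∀ i, 0 ∉ tsupport (φ i) := fun i h' => h0 (tsupport_mul_subset_right h')
  have hint : ∀ i x, Integrable fun ξ => (φ i ξ * (Real.fourierChar ⟪ξ, x⟫ : ℂ)) • T ξ (v i) := by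
    intro i x
    exact ((ContinuousLinearMap.apply ℂ H (v i)).comp Λ).integrable_comp
      (integrable_smul_gaussSymbol (hφs i).continuous (hφc i) (hφ0 i) x) |>.congr
      (Eventually.of_forall fun ξ => by simp [T])
  refine ⟨_, sum_mem_rkhsFunctions hK (s := Finset.univ) fun i _ =>
    integral_smul_gaussSymbol_mem_rkhsFunctions hK hΛF hcs (hφs i) (hφc i) (hφ0 i) (v i),
    fun x => ?_⟩
  have hhi : Integrable h := hh.continuous.integrable_of_hasCompactSupport hc
  have hchar : Continuous fun ξ : EuclideanSpace ℝ (Fin m) => (Real.fourierChar ⟪ξ, x⟫ : ℂ) :=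
    continuous_subtype_val.comp (Real.continuous_fourierChar.comp (by fun_prop))
  have hhx : Integrable fun ξ => h ξ * (Real.fourierChar ⟪ξ, x⟫ : ℂ) :=
    (hh.continuous.mul hchar).integrable_of_hasCompactSupport hc.mul_right
  rw [← integral_finsetSum _ fun i _ => hint i x, ← integral_smul_const, ← integral_sub
    (integrable_finsetSum _ fun i _ => hint i x) (hhx.smul_const u), ← integral_const_mul]
  refine norm_integral_le_of_norm_le (hhi.norm.const_mul ε) (Eventually.of_forall fun ξ => ?_)
  by_cases hξ : ξ ∈ tsupport h
  · have h1 : ∑ i, ρ i ξ = 1 := by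
      rw [← finsum_eq_sum_of_fintype]; exact ρ.sum_eq_one hξ
    have e : ∑ i, (φ i ξ * (Real.fourierChar ⟪ξ, x⟫ : ℂ)) • T ξ (v i) -
        (h ξ * (Real.fourierChar ⟪ξ, x⟫ : ℂ)) • u =
        (h ξ * (Real.fourierChar ⟪ξ, x⟫ : ℂ)) • ∑ i, (ρ i ξ : ℂ) • (T ξ (v i) - u) := by
      simp only [smul_sub, Finset.sum_sub_distrib, ← Finset.sum_smul, ← Complex.ofReal_sum, h1,
        Complex.ofReal_one, one_smul, Finset.smul_sum, smul_smul]
      congr 1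
      refine Finset.sum_congr rfl fun i _ => ?_
      congr 1
      simp only [φ]; ring
    rw [e, norm_smul, norm_mul, Circle.norm_coe, mul_one, mul_comm]
    gcongr
    calc ‖∑ i, (ρ i ξ : ℂ) • (T ξ (v i) - u)‖ ≤ ∑ i, ρ i ξ * ε := by
          refine (norm_sum_le _ _).trans (Finset.sum_le_sum fun i _ => ?_)
          rw [norm_smul, Complex.norm_real, Real.norm_of_nonneg (ρ.nonneg i ξ)]
          by_cases hi : ρ i ξ = 0
          · rw [hi, zero_mul, zero_mul]
          · have : ξ ∈ U i := hρ i (subset_tsupport _ hi)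
            exact mul_le_mul_of_nonneg_left (hU i ξ this) (ρ.nonneg i ξ)
      _ = ε := by rw [← Finset.sum_mul, h1, one_mul]
  · have hz : h ξ = 0 := image_eq_zero_of_notMem_tsupport hξ
    simp [φ, hz]

/-- A smooth cutoff that removes the frequencies near the origin and near infinity. -/
theorem exists_cutoff_seq (V : Type*) [NormedAddCommGroup V] [InnerProductSpace ℝ V]
    [FiniteDimensional ℝ V] : ∃ χ : ℕ → V → ℝ, (∀ n, ContDiff ℝ ∞ (χ n)) ∧
      (∀ n, HasCompactSupport (χ n)) ∧ (∀ n, 0 ∉ tsupport (χ n)) ∧ (∀ n ξ, |χ n ξ| ≤ 1) ∧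
      ∀ ξ, ξ ≠ 0 → Tendsto (fun n => χ n ξ) atTop (𝓝 1) := by
  let b : ContDiffBump (0 : V) := ⟨1, 2, one_pos, one_lt_two⟩
  have hb1 : ∀ ξ : V, ‖ξ‖ ≤ 1 → b ξ = 1 := fun ξ h =>
    b.one_of_mem_closedBall (by simpa [b] using h)
  have hb0 : ∀ ξ : V, 2 ≤ ‖ξ‖ → b ξ = 0 := fun ξ h => b.zero_of_le_dist (by simpa [b] using h)
  refine ⟨fun n ξ => b ((n + 1 : ℝ)⁻¹ • ξ) - b ((n + 1 : ℝ) • ξ), fun n => ?_, fun n => ?_,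
    fun n => ?_, fun n ξ => ?_, fun ξ hξ => ?_⟩
  · exact (b.contDiff.comp (contDiff_const_smul _)).sub (b.contDiff.comp (contDiff_const_smul _))
  · refine HasCompactSupport.intro (isCompact_closedBall (0 : V) (2 * (n + 1))) fun ξ hξ => ?_
    have hξ' : 2 * ((n : ℝ) + 1) < ‖ξ‖ := by simpa using hξ
    have hn : (0 : ℝ) < n + 1 := by positivity
    simp only
    rw [hb0, hb0, sub_zero]
    · rw [norm_smul, Real.norm_of_nonneg hn.le]
      nlinarith
    · rw [norm_smul, norm_inv, Real.norm_of_nonneg hn.le, le_inv_mul_iff₀ hn]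
      linarith
  · rw [notMem_tsupport_iff_eventuallyEq]
    have hn : (0 : ℝ) < n + 1 := by positivity
    filter_upwards [Metric.closedBall_mem_nhds (0 : V) (inv_pos.2 hn)] with ξ hξ
    have hξ' : ‖ξ‖ ≤ (n + 1 : ℝ)⁻¹ := by simpa using hξ
    have h1 : (n + 1 : ℝ)⁻¹ ≤ 1 := inv_le_one_of_one_le₀ (by linarith [n.cast_nonneg (α := ℝ)])
    rw [hb1, hb1, sub_self, Pi.zero_apply]
    · rw [norm_smul, Real.norm_of_nonneg hn.le]
      calc _ ≤ (n + 1 : ℝ) * (n + 1 : ℝ)⁻¹ := by gcongr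
        _ = 1 := mul_inv_cancel₀ hn.ne'
    · rw [norm_smul, norm_inv, Real.norm_of_nonneg hn.le]
      exact mul_le_one₀ h1 (norm_nonneg _) (hξ'.trans h1)
  · have h1 := b.nonneg (x := (n + 1 : ℝ)⁻¹ • ξ)
    have h2 := b.le_one (x := (n + 1 : ℝ)⁻¹ • ξ)
    have h3 := b.nonneg (x := (n + 1 : ℝ) • ξ)
    have h4 := b.le_one (x := (n + 1 : ℝ) • ξ)
    rw [abs_le]
    constructor <;> linarith
  · refine tendsto_const_nhds.congr' ?_
    obtain ⟨N, hN⟩ := exists_nat_ge (max ‖ξ‖ (2 * ‖ξ‖⁻¹))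
    filter_upwards [eventually_ge_atTop N] with n hn
    have hn' : (N : ℝ) ≤ n := by exact_mod_cast hn
    have hpos : (0 : ℝ) < n + 1 := by positivity
    have hξ0 : 0 < ‖ξ‖ := norm_pos_iff.2 hξ
    rw [hb1, hb0, sub_zero]
    · rw [norm_smul, Real.norm_of_nonneg hpos.le, ← div_le_iff₀ hξ0, div_eq_mul_inv]
      linarith [le_max_right ‖ξ‖ (2 * ‖ξ‖⁻¹)]
    · rw [norm_smul, norm_inv, Real.norm_of_nonneg hpos.le, inv_mul_le_iff₀ hpos]
      linarith [le_max_left ‖ξ‖ (2 * ‖ξ‖⁻¹)]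

/-- Removing from the Fourier transform of `ρ` the frequencies near the origin and near infinity
changes it little in `L¹`, hence changes `ρ` little in the uniform norm. -/
theorem exists_rkhsFunctions_approx_smooth [Nontrivial (EuclideanSpace ℝ (Fin m))]
    {F : ℝ≥0 → H →L[ℂ] H} (hK : IsPDKernel (radialKernel F m))
    {Λ : C(I, ℂ) →L[ℂ] H →L[ℂ] H} (hΛF : ∀ t, Λ (rpowI (t ^ 2)) = F t)
    (hcs : ∀ v, Continuous (scalarProjection F v))
    (hdense : ∀ τ : ℝ, 0 < τ →
      DenseRange (Λ (gaussSymbol (Module.finrank ℝ (EuclideanSpace ℝ (Fin m))) τ)))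
    {ρ : EuclideanSpace ℝ (Fin m) → ℂ} (hρ : ContDiff ℝ ∞ ρ) (hc : HasCompactSupport ρ)
    (u : H) {ε : ℝ} (hε : 0 < ε) :
    ∃ f ∈ rkhsFunctions hK, ∀ x, ‖f x - ρ x • u‖ ≤ ε := by
  set ψ : 𝓢(EuclideanSpace ℝ (Fin m), ℂ) := hc.toSchwartzMap hρ
  set h : 𝓢(EuclideanSpace ℝ (Fin m), ℂ) := 𝓕 ψ with hh
  have hρh : ∀ x, ρ x = ∫ ξ, h ξ * (Real.fourierChar ⟪ξ, x⟫ : ℂ) := by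
    intro x
    have h1 : (𝓕⁻ h : 𝓢(EuclideanSpace ℝ (Fin m), ℂ)) x = ρ x := by
      rw [hh, FourierTransform.fourierInv_fourier_eq]; rfl
    rw [← h1, SchwartzMap.fourierInv_coe, Real.fourierInv_eq]
    refine integral_congr_ae (Eventually.of_forall fun ξ => ?_)
    simp only [Circle.smul_def, smul_eq_mul]
    ring
  obtain ⟨χ, hχs, hχc, hχ0, hχb, hχl⟩ := exists_cutoff_seq (EuclideanSpace ℝ (Fin m))
  have hlim : Tendsto (fun n => ∫ ξ, ‖(1 - (χ n ξ : ℂ)) * h ξ‖) atTop (𝓝 0) := by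
    have hz : (0 : ℝ) = ∫ ξ : EuclideanSpace ℝ (Fin m), (0 : ℝ) := by simp
    rw [hz]
    refine tendsto_integral_of_dominated_convergence (fun ξ => 2 * ‖h ξ‖) (fun n => ?_)
      (h.integrable.norm.const_mul 2) (fun n => Eventually.of_forall fun ξ => ?_) ?_
    · refine Continuous.aestronglyMeasurable ?_
      have := (hχs n).continuous
      have := h.continuous
      fun_prop
    · rw [norm_norm, norm_mul]
      gcongr
      calc ‖1 - (χ n ξ : ℂ)‖ ≤ ‖(1 : ℂ)‖ + ‖(χ n ξ : ℂ)‖ := norm_sub_le _ _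
        _ ≤ 1 + 1 := by
          rw [norm_one, Complex.norm_real]
          gcongr
          exact hχb n ξ
        _ = 2 := by norm_num
    · have hne := (Set.countable_singleton (0 : EuclideanSpace ℝ (Fin m))).ae_notMem volume
      filter_upwards [hne] with ξ hξ
      have h1 : Tendsto (fun n => ‖(1 - (χ n ξ : ℂ)) * h ξ‖) atTop
          (𝓝 ‖(1 - ((1 : ℝ) : ℂ)) * h ξ‖) :=
        ((tendsto_const_nhds.sub ((Complex.continuous_ofReal.tendsto _).comp (hχl ξ hξ))).mul
          tendsto_const_nhds).norm
      simpa using h1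
  obtain ⟨n, hn⟩ := (hlim.eventually_lt_const
    (show 0 < ε / (2 * (‖u‖ + 1)) by positivity)).exists
  set g : EuclideanSpace ℝ (Fin m) → ℂ := fun ξ => (χ n ξ : ℂ) * h ξ
  have hgs : ContDiff ℝ ∞ g := (Complex.ofRealCLM.contDiff.comp (hχs n)).mul (h.smooth _)
  have hχc' : HasCompactSupport fun ξ => (χ n ξ : ℂ) := (hχc n).comp_left Complex.ofReal_zero
  have hgc : HasCompactSupport g := hχc'.mul_right
  have hg0 : 0 ∉ tsupport g := fun h' => hχ0 n (by
    refine closure_mono ?_ h'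
    intro ξ hξ h1
    exact hξ (by simp [g, h1]))
  obtain ⟨f, hf, hfg⟩ := exists_rkhsFunctions_approx_fourierInv hK hΛF hcs hdense hgs hgc hg0 u
    (show 0 < ε / (2 * ((∫ ξ, ‖g ξ‖) + 1)) by
      have : 0 ≤ ∫ ξ, ‖g ξ‖ := integral_nonneg fun ξ => norm_nonneg _
      positivity)
  refine ⟨f, hf, fun x => ?_⟩
  have hchar : Continuous fun ξ : EuclideanSpace ℝ (Fin m) => (Real.fourierChar ⟪ξ, x⟫ : ℂ) :=
    continuous_subtype_val.comp (Real.continuous_fourierChar.comp (by fun_prop))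
  have hgi : Integrable fun ξ => g ξ * (Real.fourierChar ⟪ξ, x⟫ : ℂ) :=
    (hgs.continuous.mul hchar).integrable_of_hasCompactSupport hgc.mul_right
  have hhi : Integrable fun ξ => h ξ * (Real.fourierChar ⟪ξ, x⟫ : ℂ) := by
    refine h.integrable.mono (h.continuous.mul hchar).aestronglyMeasurable
      (Eventually.of_forall fun ξ => ?_)
    rw [norm_mul, Circle.norm_coe, mul_one]
  have h1 : ‖(∫ ξ, g ξ * (Real.fourierChar ⟪ξ, x⟫ : ℂ)) - ρ x‖ ≤ ε / (2 * (‖u‖ + 1)) := by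
    rw [hρh, ← integral_sub hgi hhi]
    refine (norm_integral_le_integral_norm _).trans (le_of_eq_of_le ?_ hn.le)
    refine integral_congr_ae (Eventually.of_forall fun ξ => ?_)
    simp only
    rw [← sub_mul, norm_mul, Circle.norm_coe, mul_one, norm_sub_rev]
    congr 1
    simp only [g]; ring
  have hI : 0 ≤ ∫ ξ, ‖g ξ‖ := integral_nonneg fun ξ => norm_nonneg _
  calc ‖f x - ρ x • u‖ = ‖(f x - (∫ ξ, g ξ * (Real.fourierChar ⟪ξ, x⟫ : ℂ)) • u) +
        ((∫ ξ, g ξ * (Real.fourierChar ⟪ξ, x⟫ : ℂ)) - ρ x) • u‖ := by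
          rw [sub_smul, sub_add_sub_cancel]
    _ ≤ ε / (2 * ((∫ ξ, ‖g ξ‖) + 1)) * (∫ ξ, ‖g ξ‖) + ε / (2 * (‖u‖ + 1)) * ‖u‖ := by
        refine (norm_add_le _ _).trans (add_le_add (hfg x) ?_)
        rw [norm_smul]
        gcongr
    _ ≤ ε / (2 * ((∫ ξ, ‖g ξ‖) + 1)) * ((∫ ξ, ‖g ξ‖) + 1) + ε / (2 * (‖u‖ + 1)) * (‖u‖ + 1) := by
        gcongr <;> linarith
    _ = ε := by field_simp; ring

/-- Approximation on a set `B` of functions that are continuous on a compact set `A` and small on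
the rest of `B`. The choice `B = A` covers uniform approximation on compact sets, the choice
`B = univ` covers uniform approximation of functions vanishing at infinity. -/
theorem exists_rkhsFunctions_approx_on [Nontrivial (EuclideanSpace ℝ (Fin m))]
    {F : ℝ≥0 → H →L[ℂ] H} (hK : IsPDKernel (radialKernel F m))
    {Λ : C(I, ℂ) →L[ℂ] H →L[ℂ] H} (hΛF : ∀ t, Λ (rpowI (t ^ 2)) = F t)
    (hcs : ∀ v, Continuous (scalarProjection F v))
    (hdense : ∀ τ : ℝ, 0 < τ →
      DenseRange (Λ (gaussSymbol (Module.finrank ℝ (EuclideanSpace ℝ (Fin m))) τ)))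
    {A B : Set (EuclideanSpace ℝ (Fin m))} (hA : IsCompact A) {g : EuclideanSpace ℝ (Fin m) → H}
    {ε : ℝ} (hε : 0 < ε) (hgA : ∀ a ∈ A, ∀ᶠ x in 𝓝 a, x ∈ B → ‖g x - g a‖ ≤ ε)
    (hgB : ∀ x ∈ B, x ∉ A → ‖g x‖ ≤ ε) :
    ∃ f ∈ rkhsFunctions hK, ∀ x ∈ B, ‖f x - g x‖ ≤ 2 * ε := by
  have hloc : ∀ a : A, ∃ U : Set (EuclideanSpace ℝ (Fin m)), IsOpen U ∧
      (a : EuclideanSpace ℝ (Fin m)) ∈ U ∧ Bornology.IsBounded U ∧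
      ∀ x ∈ U, x ∈ B → ‖g x - g a‖ ≤ ε := by
    intro a
    obtain ⟨U, hU, hUo, hmem⟩ := eventually_nhds_iff.1 (hgA a a.2)
    exact ⟨U ∩ Metric.ball a 1, hUo.inter Metric.isOpen_ball,
      ⟨hmem, Metric.mem_ball_self one_pos⟩,
      Metric.isBounded_ball.subset Set.inter_subset_right, fun x hx => hU x hx.1⟩
  choose U hUo hmem hUb hU using hloc
  obtain ⟨t, ht⟩ := hA.elim_finite_subcover U hUo
    fun a ha => Set.mem_iUnion.2 ⟨⟨a, ha⟩, hmem ⟨a, ha⟩⟩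
  obtain ⟨ρ, hρ⟩ := SmoothPartitionOfUnity.exists_isSubordinate
    𝓘(ℝ, EuclideanSpace ℝ (Fin m)) hA.isClosed (fun i : t => U i) (fun i => hUo i) (by
      intro ξ hξ
      obtain ⟨i, hi, hξi⟩ := Set.mem_iUnion₂.1 (ht hξ)
      exact Set.mem_iUnion.2 ⟨⟨i, hi⟩, hξi⟩)
  have hcomp : ∀ i : t, HasCompactSupport (ρ i) := fun i =>
    Metric.isCompact_of_isClosed_isBounded (isClosed_tsupport _) ((hUb i).subset (hρ i))
  have happ : ∀ i : t, ∃ f ∈ rkhsFunctions hK, ∀ x,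
      ‖f x - (ρ i x : ℂ) • g i‖ ≤ ε / (t.card + 1) := fun i =>
    exists_rkhsFunctions_approx_smooth hK hΛF hcs hdense (ρ := fun x => (ρ i x : ℂ))
      (Complex.ofRealCLM.contDiff.comp (ρ i).contMDiff.contDiff)
      ((hcomp i).comp_left Complex.ofReal_zero) (g i) (by positivity)
  choose f hf hfρ using happ
  refine ⟨_, sum_mem_rkhsFunctions hK (s := Finset.univ) fun i _ => hf i, fun x hx => ?_⟩
  have hsum : ∑ i, ρ i x ≤ 1 := by
    rw [← finsum_eq_sum_of_fintype]; exact ρ.sum_le_one x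
  have h1 : ‖∑ i, f i x - ∑ i, (ρ i x : ℂ) • g i‖ ≤ ε := by
    rw [← Finset.sum_sub_distrib]
    calc _ ≤ ∑ i : t, ε / (t.card + 1) :=
          (norm_sum_le _ _).trans (Finset.sum_le_sum fun i _ => hfρ i x)
      _ = t.card * (ε / (t.card + 1)) := by simp
      _ ≤ (t.card + 1) * (ε / (t.card + 1)) := by gcongr; linarith
      _ = ε := by field_simp
  have h2 : ‖∑ i, (ρ i x : ℂ) • g i - g x‖ ≤ ε := by
    have e : ∑ i, (ρ i x : ℂ) • g i - g x =
        ∑ i, (ρ i x : ℂ) • (g i - g x) - ((1 - ∑ i, ρ i x : ℝ) : ℂ) • g x := by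
      simp only [smul_sub, Finset.sum_sub_distrib, ← Finset.sum_smul]
      push_cast
      rw [sub_smul, one_smul]
      abel
    have h3 : ‖((1 - ∑ i, ρ i x : ℝ) : ℂ) • g x‖ ≤ (1 - ∑ i, ρ i x) * ε := by
      rw [norm_smul, Complex.norm_real, Real.norm_of_nonneg (sub_nonneg.2 hsum)]
      by_cases hxA : x ∈ A
      · have : ∑ i, ρ i x = 1 := by
          rw [← finsum_eq_sum_of_fintype]; exact ρ.sum_eq_one hxA
        rw [this, sub_self, zero_mul, zero_mul]
      · exact mul_le_mul_of_nonneg_left (hgB x hx hxA) (sub_nonneg.2 hsum)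
    have h4 : ‖∑ i, (ρ i x : ℂ) • (g i - g x)‖ ≤ (∑ i, ρ i x) * ε := by
      rw [Finset.sum_mul]
      refine (norm_sum_le _ _).trans (Finset.sum_le_sum fun i _ => ?_)
      rw [norm_smul, Complex.norm_real, Real.norm_of_nonneg (ρ.nonneg i x)]
      by_cases hi : ρ i x = 0
      · rw [hi, zero_mul, zero_mul]
      · have : x ∈ U i := hρ i (subset_tsupport _ hi)
        rw [norm_sub_rev]
        exact mul_le_mul_of_nonneg_left (hU i x this hx) (ρ.nonneg i x)
    rw [e]
    refine (norm_sub_le _ _).trans ((add_le_add h4 h3).trans_eq ?_)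
    ring
  calc _ = ‖(∑ i, f i x - ∑ i, (ρ i x : ℂ) • g i) + (∑ i, (ρ i x : ℂ) • g i - g x)‖ := by
        rw [sub_add_sub_cancel]
    _ ≤ ε + ε := (norm_add_le _ _).trans (add_le_add h1 h2)
    _ = 2 * ε := by ring

end Approximation

/-! ### Universality of radial kernels -/

section Universality

variable {H : Type*} [NormedAddCommGroup H] [InnerProductSpace ℂ H] {m : ℕ}
  {F : ℝ≥0 → H →L[ℂ] H} {Λ : C(I, ℂ) →L[ℂ] H →L[ℂ] H}

theorem isPDKernel_radialKernel (hΛ : IsCompletelyPositive Λ)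
    (hΛF : ∀ t, Λ (rpowI (t ^ 2)) = F t) (m : ℕ) : IsPDKernel (radialKernel F m) := by
  intro n x v hx
  have := hΛ (fun i j => rpowI (‖x i - x j‖₊ ^ 2)) v fun t => posSemidef_rpowI hx t
  simpa only [hΛF, radialKernel] using this

variable [CompleteSpace H]

theorem isUniversalKernel_radialKernel [Nontrivial (EuclideanSpace ℝ (Fin m))]
    (hK : IsPDKernel (radialKernel F m)) (hcont : ∀ f ∈ rkhsFunctions hK, Continuous f)
    (hΛF : ∀ t, Λ (rpowI (t ^ 2)) = F t) (hcs : ∀ v, Continuous (scalarProjection F v))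
    (hdense : ∀ τ : ℝ, 0 < τ →
      DenseRange (Λ (gaussSymbol (Module.finrank ℝ (EuclideanSpace ℝ (Fin m))) τ))) :
    IsUniversalKernel (radialKernel F m) := by
  classical
  refine ⟨hK, hcont, fun A hA g hg ε hε => ?_⟩
  -- The junk value of `g'` off `A` is never compared with anything.
  let g' : EuclideanSpace ℝ (Fin m) → H := fun x => if h : x ∈ A then g ⟨x, h⟩ else 0
  have hg' : ∀ x : A, g' x = g x := fun x => by simp [g']
  obtain ⟨f, hf, hfg⟩ := exists_rkhsFunctions_approx_on hK hΛF hcs hdense (B := A) hA (g := g')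
    (show 0 < ε / 3 by positivity) (fun a ha => by
      have h1 : ∀ᶠ x in 𝓝 (⟨a, ha⟩ : A), ‖g x - g ⟨a, ha⟩‖ < ε / 3 := by
        have := hg.continuousAt.eventually_mem
          (Metric.ball_mem_nhds (g ⟨a, ha⟩) (show 0 < ε / 3 by positivity))
        simpa only [Metric.mem_ball, dist_eq_norm] using this
      rw [nhds_subtype_eq_comap, eventually_comap] at h1
      filter_upwards [h1] with x hx hxA
      rw [hg' ⟨x, hxA⟩, hg' ⟨a, ha⟩]
      exact (hx ⟨x, hxA⟩ rfl).le) (fun x hx hxA => absurd hx hxA)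
  refine ⟨f, hf, fun x => ?_⟩
  have := hfg x x.2
  rw [hg'] at this
  linarith

theorem isCZeroUniversalKernel_radialKernel [Nontrivial (EuclideanSpace ℝ (Fin m))]
    (hK : IsPDKernel (radialKernel F m)) (hcz : ∀ f ∈ rkhsFunctions hK, IsCZero f)
    (hΛF : ∀ t, Λ (rpowI (t ^ 2)) = F t) (hcs : ∀ v, Continuous (scalarProjection F v))
    (hdense : ∀ τ : ℝ, 0 < τ →
      DenseRange (Λ (gaussSymbol (Module.finrank ℝ (EuclideanSpace ℝ (Fin m))) τ))) :
    IsCZeroUniversalKernel (radialKernel F m) := by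
  refine ⟨hK, hcz, fun g hg ε hε => ?_⟩
  obtain ⟨A, hA, hAε⟩ := hg.2 (ε / 3) (by positivity)
  obtain ⟨f, hf, hfg⟩ := exists_rkhsFunctions_approx_on hK hΛF hcs hdense (B := Set.univ) hA
    (g := g) (show 0 < ε / 3 by positivity) (fun a _ => by
      have := (hg.1.tendsto a).eventually_mem
        (Metric.ball_mem_nhds (g a) (show 0 < ε / 3 by positivity))
      filter_upwards [this] with x hx _
      rw [← dist_eq_norm]
      exact (Metric.mem_ball.1 hx).le) (fun x _ hxA => (hAε x hxA).le)
  refine ⟨f, hf, fun x => ?_⟩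
  have := hfg x (Set.mem_univ x)
  linarith

end Universality

theorem mainTheorem3 {H : Type*} [NormedAddCommGroup H] [InnerProductSpace ℂ H] [CompleteSpace H]
    [TopologicalSpace.SeparableSpace H]
    (F : ℝ≥0 → H →L[ℂ] H)
    (hF : UltraweaklyContinuous F)
    (hF0 : IsTraceClassOperator (F 0))
    (hpd : ∀ m : ℕ, 1 ≤ m → ∀ v : H, IsPDScalarKernel
      (fun x y : EuclideanSpace ℝ (Fin m) => scalarProjection F v ‖x - y‖₊)) :
    ∀ m : ℕ, 1 ≤ m →
      ∃ hK : IsPDKernel (radialKernel F m),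
        (∀ f ∈ rkhsFunctions hK, Continuous f) ∧
        List.TFAE [
          IsStrictlyPDKernel (radialKernel F m),
          IsUniversalKernel (radialKernel F m),
          ∀ v : H, v ≠ 0 → ¬ ∃ c : ℂ, ∀ t, scalarProjection F v t = c] ∧
        ((∀ f ∈ rkhsFunctions hK, IsCZero f) ↔
          ∀ v : H, v ≠ 0 → IsCZero (scalarProjection F v)) ∧
        ((∀ f ∈ rkhsFunctions hK, IsCZero f) →
          List.TFAE [
            IsStrictlyPDKernel (radialKernel F m),
            IsCZeroUniversalKernel (radialKernel F m),
            ∀ v : H, v ≠ 0 → ∃ t, scalarProjection F v t ≠ 0]) := by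
  have hrad : ∀ v, IsPDRadial fun r => scalarProjection F v (NNReal.sqrt r) := fun v =>
    isPDRadial_of_forall fun m hm => hpd m hm v
  have hcs : ∀ v, Continuous (scalarProjection F v) := fun v => hF.continuous_inner v v
  obtain ⟨Λ, hΛ, hΛG⟩ := exists_completelyPositive_rpowI (G := fun r => F (NNReal.sqrt r)) hrad
    fun u v => (hF.continuous_inner u v).comp NNReal.continuous_sqrt
  have hΛF : ∀ t, Λ (rpowI (t ^ 2)) = F t := fun t => by rw [hΛG, NNReal.sqrt_sq]
  have hB : ∀ t, ‖F t‖ ≤ ‖Λ‖ := by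
    intro t
    have h1 : ‖rpowI (t ^ 2)‖ ≤ 1 := (ContinuousMap.norm_le _ zero_le_one).2 fun x => by
      rw [rpowI_apply, Complex.norm_real, Real.norm_of_nonneg (Real.rpow_nonneg x.2.1 _)]
      exact Real.rpow_le_one x.2.1 x.2.2 (NNReal.coe_nonneg _)
    rw [← hΛF]
    exact (Λ.le_opNorm _).trans (mul_le_of_le_one_right (norm_nonneg _) h1)
  have hcF : ∀ v, Continuous fun t => F t v := fun v =>
    continuous_apply_of_isPDRadial hrad hB (hcs v)
  intro m hm
  have : Nonempty (Fin m) := ⟨⟨0, hm⟩⟩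
  have hK := isPDKernel_radialKernel hΛ hΛF m
  have hdense : (∀ v : H, v ≠ 0 → ¬ ∃ c : ℂ, ∀ t, scalarProjection F v t = c) → ∀ τ : ℝ, 0 < τ →
      DenseRange (Λ (gaussSymbol (Module.finrank ℝ (EuclideanSpace ℝ (Fin m))) τ)) := fun h τ hτ =>
    denseRange_gaussSymbol hΛ hΛF hcs h Module.finrank_pos hτ
  have hcont := rkhsFunctions_continuous hK hcF
  have hiff := rkhsFunctions_isCZero_iff hm hK hrad hB hcs
  refine ⟨hK, hcont, ?_, hiff, fun hcz => ?_⟩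
  · tfae_have 1 → 3 := fun h v hv => h.scalarProjection_not_const hm hv
    tfae_have 3 → 2 := fun h =>
      isUniversalKernel_radialKernel hK hcont hΛF hcs (hdense h)
    tfae_have 2 → 1 := fun h => h.isStrictlyPDKernel
    tfae_finish
  · tfae_have 1 → 3 := fun h v hv => h.exists_scalarProjection_ne_zero hv
    tfae_have 3 → 2 := fun h =>
      isCZeroUniversalKernel_radialKernel hK hcz hΛF hcs (hdense fun v hv =>
        not_const_of_isCZero (hiff.1 hcz v hv) (h v hv))
    tfae_have 2 → 1 := fun h => h.isStrictlyPDKernel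
    tfae_finish
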